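/- For a real random variable $z$ write $z\sim\mathrm{subG}(\sigma^2)$ if $\sup_{p\ge 1}p^{-1/2}(\mathbb E|z|^p)^{1/p}\le\sigma$, and for a random vector $z$ in $\mathbb R^d$ write $z\sim\mathrm{subG}_d(\tau^2)$ if $\langle\theta,z\rangle\sim\mathrm{subG}(\tau^2)$ for every $\theta$ with $\|\theta\|_2=1$. Let $d=d_1+d_2\ge 1$ and let $\mathcal D$ be a probability distribution of a pair $(x,y)\in\mathbb R^d\times\mathbb R$ with $x\sim\mathrm{subG}_d(\tau^2)$, $y\sim\mathrm{subG}(\sigma^2)$ and $\Sigma=\mathbb E[xx^\top]\succ 0$; let $\lambda_{\min}(\Sigma)$ be the smallest eigenvalue of $\Sigma$. Write $x=(x^{(1)},x^{(2)})$ with $x^{(1)}\in\mathbb R^{d_1}$, and let $\beta^\star\in\arg\min_{\beta\in\mathbb R^d}\mathbb E(\langle\beta,x\rangle-y)^2$, $\beta_1^\star\in\arg\min_{\beta\in\mathbb R^{d_1}}\mathbb E(\langle\beta,x^{(1)}\rangle-y)^2$ and $\mathcal E=\mathbb E(\langle\beta^\star,x\rangle-\langle\beta_1^\star,x^{(1)}\rangle)^2$.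 Let $(x_1,y_1),\dots,(x_n,y_n)$, $n\ge 2$, be i.i.d. from $\mathcal D$, and independently let $u_1,\dots,u_m$ be i.i.d. from the $x$-marginal of $\mathcal D$. Put $\widehat\Sigma=\frac1m\sum_{t}u_tu_t^\top$, $\widehat\Sigma_1=\frac1m\sum_t u_t^{(1)}u_t^{(1)\top}$, $\widehat D=\begin{pmatrix}\widehat\Sigma_1&0\\0&0\end{pmatrix}\in\mathbb R^{d\times d}$ and $\widehat R=\widehat D^\dagger-\widehat\Sigma^\dagger$ (pseudoinverses), and let EstimateResidual return $$\widehat{\mathcal E}=\binom n2^{-1}\sum_{s<t}\big\langle\widehat\Sigma^{1/2}\widehat Rx_sy_s,\ \widehat\Sigma^{1/2}\widehat Rx_ty_t\big\rangle.$$ Theorem 1 (thm:residual_est_main). There are universal constants $C,C'>0$ such that, for all data as above and every $\delta\in(0,1)$, if $m\ge C\,(d+\log(2/\delta))\,\tau^4/\lambda_{\min}^2(\Sigma)$, then with probability at least $1-\delta$ over all the samples, $$|\widehat{\mathcal E}-\mathcal E|\le\frac12\mathcal E+C'\left(\frac{\sigma^2\tau^4}{\lambda_{\min}^2(\Sigma)}\cdot\frac{d^{1/2}\log^2(2d/\delta)}{n}+\frac{\tau^6}{\lambda_{\min}^4(\Sigma)}\cdot\frac{d\log(2/\delta)}{m}\cdot\|\mathbb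 E[xy]\|_2^2\right).$$ -/

import Mathlib

open MeasureTheory
open scoped Matrix ENNReal

noncomputable section

namespace ResidualEstimation

/-- `z ∼ subG(σ²)`: `sup_{p ≥ 1} p^{-1/2} (E|z|^p)^{1/p} ≤ σ`, with `p` ranging over the reals. -/
def IsSubG {Ω : Type*} [MeasurableSpace Ω] (P : Measure Ω) (z : Ω → ℝ) (σ : ℝ) : Prop :=
  ∀ p : ℝ, 1 ≤ p → eLpNorm z (ENNReal.ofReal p) P ≤ ENNReal.ofReal (σ * √p)

/-- `z ∼ subG_d(τ²)`: `⟨θ, z⟩ ∼ subG(τ²)` for every unit vector `θ`. -/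
def IsSubGVec {Ω ι : Type*} [MeasurableSpace Ω] [Fintype ι] (P : Measure Ω)
    (z : Ω → EuclideanSpace ℝ ι) (τ : ℝ) : Prop :=
  ∀ θ : EuclideanSpace ℝ ι, ‖θ‖ = 1 → IsSubG P (fun ω => inner ℝ θ (z ω)) τ

/-- The first `d₁` coordinates `x⁽¹⁾` of `x = (x⁽¹⁾, x⁽²⁾)`. -/
def head {d₁ d₂ : ℕ} (x : EuclideanSpace ℝ (Fin d₁ ⊕ Fin d₂)) : EuclideanSpace ℝ (Fin d₁) :=
  WithLp.toLp 2 (fun i => x (Sum.inl i))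

/-- The smallest eigenvalue of a symmetric matrix. -/
def lambdaMin {ι : Type*} [Fintype ι] [DecidableEq ι] (A : Matrix ι ι ℝ) : ℝ :=
  sInf (spectrum ℝ A)

/-- The pseudoinverse of a symmetric matrix: each nonzero eigenvalue is inverted and the
eigenvalue zero is kept (in Lean `0⁻¹ = 0`). See `pinv_penrose`. -/
def pinv {ι : Type*} [Fintype ι] [DecidableEq ι] (A : Matrix ι ι ℝ) : Matrix ι ι ℝ :=
  cfc (fun t : ℝ => t⁻¹) A

/-- The square root of a symmetric positive semidefinite matrix. See `matSqrt_spec`. -/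
def matSqrt {ι : Type*} [Fintype ι] [DecidableEq ι] (A : Matrix ι ι ℝ) : Matrix ι ι ℝ :=
  cfc Real.sqrt A

/-- The second moment matrix `E[x xᵀ]` of a random vector. -/
def secondMoment {Ω ι : Type*} [MeasurableSpace Ω] (P : Measure Ω)
    (x : Ω → EuclideanSpace ℝ ι) : Matrix ι ι ℝ :=
  Matrix.of fun i j => ∫ ω, x ω i * x ω j ∂P

/-- The empirical second moment matrix `(1/m) ∑ₜ uₜ uₜᵀ`. -/
def empSecondMoment {ι : Type*} {m : ℕ} (u : Fin m → EuclideanSpace ℝ ι) : Matrix ι ι ℝ :=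
  (m : ℝ)⁻¹ • ∑ t, Matrix.vecMulVec (u t).ofLp (u t).ofLp

/-- `R̂ = D̂† - Σ̂†`, where `D̂` is `Σ̂₁` padded with zero blocks. -/
def Rhat {d₁ d₂ : ℕ} (S : Matrix (Fin d₁ ⊕ Fin d₂) (Fin d₁ ⊕ Fin d₂) ℝ)
    (S₁ : Matrix (Fin d₁) (Fin d₁) ℝ) : Matrix (Fin d₁ ⊕ Fin d₂) (Fin d₁ ⊕ Fin d₂) ℝ :=
  pinv (Matrix.fromBlocks S₁ 0 0 0) - pinv S

/-- The estimator `EstimateResidual` on labeled examples `z s = (x_s, y_s)` and second moment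
estimates `S`, `S₁`:
`(n choose 2)⁻¹ ∑_{s < t} ⟨S^{1/2} R̂ x_s y_s, S^{1/2} R̂ x_t y_t⟩`. -/
def estimateResidual {d₁ d₂ n : ℕ} (S : Matrix (Fin d₁ ⊕ Fin d₂) (Fin d₁ ⊕ Fin d₂) ℝ)
    (S₁ : Matrix (Fin d₁) (Fin d₁) ℝ)
    (z : Fin n → EuclideanSpace ℝ (Fin d₁ ⊕ Fin d₂) × ℝ) : ℝ :=
  ((n.choose 2 : ℕ) : ℝ)⁻¹ * ∑ s, ∑ t ∈ Finset.Ioi s,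
    ((matSqrt S * Rhat S S₁) *ᵥ ((z s).2 • (z s).1.ofLp)) ⬝ᵥ
      ((matSqrt S * Rhat S S₁) *ᵥ ((z t).2 • (z t).1.ofLp))

/-- The square loss `E(⟨β, x⟩ - y)²` of a linear predictor `β`. -/
def sqLoss {Ω ι : Type*} [MeasurableSpace Ω] [Fintype ι] (P : Measure Ω)
    (x : Ω → EuclideanSpace ℝ ι) (y : Ω → ℝ) (β : EuclideanSpace ℝ ι) : ℝ :=
  ∫ ω, (inner ℝ β (x ω) - y ω) ^ 2 ∂P

/-- `β` minimizes the square loss over all linear predictors. -/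
def IsBestLinear {Ω ι : Type*} [MeasurableSpace Ω] [Fintype ι] (P : Measure Ω)
    (x : Ω → EuclideanSpace ℝ ι) (y : Ω → ℝ) (β : EuclideanSpace ℝ ι) : Prop :=
  IsMinOn (sqLoss P x y) Set.univ β

/-- `E(⟨β, x⟩ - ⟨β₁, x⁽¹⁾⟩)²`: the square loss gap when `β`, `β₁` are the best predictors. -/
def sqGap {d₁ d₂ : ℕ} (P : Measure (EuclideanSpace ℝ (Fin d₁ ⊕ Fin d₂) × ℝ))
    (β : EuclideanSpace ℝ (Fin d₁ ⊕ Fin d₂)) (β₁ : EuclideanSpace ℝ (Fin d₁)) : ℝ :=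
  ∫ p, (inner ℝ β p.1 - inner ℝ β₁ (head p.1)) ^ 2 ∂P

/-- The joint law of `n` labeled samples drawn i.i.d. from `P` and, independently of them,
`m` unlabeled samples drawn i.i.d. from the `x`-marginal of `P`. -/
def sampleLaw {d₁ d₂ : ℕ} (P : Measure (EuclideanSpace ℝ (Fin d₁ ⊕ Fin d₂) × ℝ)) (n m : ℕ) :
    Measure ((Fin n → EuclideanSpace ℝ (Fin d₁ ⊕ Fin d₂) × ℝ) ×
      (Fin m → EuclideanSpace ℝ (Fin d₁ ⊕ Fin d₂))) :=
  (Measure.pi fun _ : Fin n => P).prod (Measure.pi fun _ : Fin m => P.map Prod.fst)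

/-- On symmetric matrices `pinv` satisfies the four Moore-Penrose equations. -/
theorem pinv_penrose {ι : Type*} [Fintype ι] [DecidableEq ι] (A : Matrix ι ι ℝ)
    (hA : A.IsHermitian) :
    A * pinv A * A = A ∧ pinv A * A * pinv A = pinv A ∧
      (A * pinv A).IsHermitian ∧ (pinv A * A).IsHermitian := by
  have hs : IsSelfAdjoint A := hA
  have hc : ∀ f : ℝ → ℝ, ContinuousOn f (spectrum ℝ A) :=
    fun f => (Matrix.finite_real_spectrum (A := A)).continuousOn f
  have h1 : A * pinv A = cfc (fun t : ℝ => t * t⁻¹) A := by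
    rw [cfc_mul (fun t : ℝ => t) (fun t : ℝ => t⁻¹) A (hc _) (hc _), cfc_id' ℝ A, pinv]
  have h2 : pinv A * A = cfc (fun t : ℝ => t⁻¹ * t) A := by
    rw [cfc_mul (fun t : ℝ => t⁻¹) (fun t : ℝ => t) A (hc _) (hc _), cfc_id' ℝ A, pinv]
  refine ⟨?_, ?_, ?_, ?_⟩
  · have h3 : A * pinv A * A = cfc (fun t : ℝ => t * t⁻¹ * t) A := by
      rw [cfc_mul (fun t : ℝ => t * t⁻¹) (fun t : ℝ => t) A (hc _) (hc _), cfc_id' ℝ A, h1]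
    rw [h3]
    simp only [mul_inv_mul_cancel]
    exact cfc_id' ℝ A
  · have h3 : pinv A * A * pinv A = cfc (fun t : ℝ => t⁻¹ * t * t⁻¹) A := by
      rw [cfc_mul (fun t : ℝ => t⁻¹ * t) (fun t : ℝ => t⁻¹) A (hc _) (hc _), h2, pinv]
    rw [h3, pinv]
    congr 1
    funext t
    by_cases ht : t = 0 <;> simp [ht]
  · rw [h1]; exact cfc_predicate _ A
  · rw [h2]; exact cfc_predicate _ A

/-- On positive semidefinite matrices `matSqrt` is the positive semidefinite square root. -/
theorem matSqrt_spec {ι : Type*} [Fintype ι] [DecidableEq ι] (A : Matrix ι ι ℝ)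
    (hA : A.PosSemidef) : (matSqrt A).PosSemidef ∧ matSqrt A * matSqrt A = A := by
  have hs : IsSelfAdjoint A := hA.isHermitian
  have hc : ∀ f : ℝ → ℝ, ContinuousOn f (spectrum ℝ A) :=
    fun f => (Matrix.finite_real_spectrum (A := A)).continuousOn f
  have hsp : ∀ t ∈ spectrum ℝ A, 0 ≤ t := by
    intro t ht
    rw [hA.isHermitian.spectrum_real_eq_range_eigenvalues] at ht
    obtain ⟨i, rfl⟩ := ht
    exact hA.eigenvalues_nonneg i
  constructor
  · have h4 : matSqrt A = (cfc (fun t => √(√t)) A)ᴴ * cfc (fun t => √(√t)) A := by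
      have hh : (cfc (fun t => √(√t)) A)ᴴ = cfc (fun t => √(√t)) A :=
        cfc_predicate (R := ℝ) (p := IsSelfAdjoint) (fun t => √(√t)) A
      rw [hh, ← cfc_mul _ _ A (hc _) (hc _), matSqrt]
      simp only [Real.mul_self_sqrt (Real.sqrt_nonneg _)]
    rw [h4]
    exact Matrix.posSemidef_conjTranspose_mul_self _
  · rw [matSqrt, ← cfc_mul _ _ A (hc _) (hc _)]
    conv_rhs => rw [← cfc_id' ℝ A]
    exact cfc_congr fun t ht => Real.mul_self_sqrt (hsp t ht)

end ResidualEstimation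

end

open ResidualEstimation

/-!
Write `Σ` and `S` for the population and the empirical second moment matrix, `b = E[x y]`, and
`G = S⁻¹ - D†`, where `D` is the upper left block of `S` padded by zeros. If `S` is positive
definite, `R S R = G` for `R = D† - S⁻¹`, so the estimator is the U-statistic with kernel
`⟨x y, G x' y'⟩` (`estimateResidual_eq_uStat`). Conditionally on the unlabeled samples its mean is
`⟨b, G b⟩`, and two errors have to be controlled.

*Bias* (`CompressedInverse.abs_sub_le`). Let `g` be the padded best predictor on the first
coordinates. The residual `r = b - Σ g` vanishes on these coordinates, hence is annihilated by `D†`,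
while `G S g = 0`. Therefore `G b = S⁻¹ r + G ((Σ - S) g)`. The quadratic form `⟨r, S⁻¹ r⟩` is
within a constant factor of the square loss gap `⟨r, Σ⁻¹ r⟩`, and the second term costs at most
`‖S - Σ‖² ‖g‖² / λ`, with `‖g‖ ≤ ‖b‖ / λ`. The operator norm `‖S - Σ‖` is bounded by a union bound
over a net (`IsSubGVec.measure_opNorm_emp_sub_gt_le`).

*Fluctuation* (`SubExpVec.measure_uStat_gt_le`). Around its mean the U-statistic is a linear
sum plus a completely degenerate double sum. The marginals of `x y` have moments growing like
`(K p) ^ p`; their exponential moments near zero give the `2k`-th moments of sums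
(`SubExpMoments.lintegral_sum_pow_le`). The degenerate part is the average, over all splittings of
the index set, of sums with rows and columns in complementary sets (`sum_offDiag_eq_decoupled`), and
each of these is a linear form in one independent half given the other. This costs a factor
`√d ‖G‖ ≤ 2 √d / λ`. Markov's inequality with `k` of order `log (2 d / δ)` concludes; the linear
part is absorbed into `⟨b, G b⟩` because `λ ‖G b‖² ≤ 2 ⟨b, G b⟩`.
-/

namespace ResidualEstimation

/-! ### Moments of sums of variables with sub-exponential tails -/


/-- Sub-exponential growth of moments: `E|X|^j ≤ (K j)^j` for every integer `j ≥ 1`. -/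
def SubExpMoments {Ω : Type*} [MeasurableSpace Ω] (μ : Measure Ω) (X : Ω → ℝ) (K : ℝ) : Prop :=
  ∀ j : ℕ, 1 ≤ j → ∫⁻ ω, ‖X ω‖ₑ ^ j ∂μ ≤ ENNReal.ofReal ((K * j) ^ j)

section Moments

variable {Ω : Type*} [MeasurableSpace Ω] {μ : Measure Ω}

theorem SubExpMoments.mono {X : Ω → ℝ} {a b : ℝ} (h : SubExpMoments μ X a) (ha : 0 ≤ a)
    (hab : a ≤ b) : SubExpMoments μ X b :=
  fun j hj => (h j hj).trans (ENNReal.ofReal_le_ofReal (by gcongr))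

theorem IsSubG.memLp {X : Ω → ℝ} {a : ℝ} (h : IsSubG μ X a) (hX : Measurable X) :
    MemLp X 2 μ := by
  refine ⟨hX.aestronglyMeasurable, ?_⟩
  have := h 2 (by norm_num)
  simp only [ENNReal.ofReal_ofNat] at this
  exact this.trans_lt ENNReal.ofReal_lt_top

/-- The product of two sub-Gaussian variables has sub-exponential moments, by Cauchy-Schwarz. -/
theorem IsSubG.mul {X Y : Ω → ℝ} {a b : ℝ} (hX : IsSubG μ X a) (hY : IsSubG μ Y b) (ha : 0 ≤ a)
    (hb : 0 ≤ b) (hXm : Measurable X) (hYm : Measurable Y) :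
    SubExpMoments μ (fun ω => X ω * Y ω) (2 * a * b) := by
  intro j hj
  have hj' : (1 : ℝ) ≤ j := by exact_mod_cast hj
  have h1 := hX (2 * j) (by linarith)
  have h2 := hY (2 * j) (by linarith)
  have : ENNReal.HolderTriple (ENNReal.ofReal (2 * j)) (ENNReal.ofReal (2 * j)) (j : ℝ≥0∞) := by
    constructor
    have : ENNReal.ofReal (2 * j) = 2 * (j : ℝ≥0∞) := by
      rw [ENNReal.ofReal_mul (by norm_num)]; simp
    rw [this, ENNReal.mul_inv (by simp) (by simp), ← two_mul, ← mul_assoc,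
      ENNReal.mul_inv_cancel (by simp) (by simp), one_mul]
  have h3 := eLpNorm_smul_le_mul_eLpNorm (p := ENNReal.ofReal (2 * j))
    (q := ENNReal.ofReal (2 * j)) (r := (j : ℝ≥0∞)) (μ := μ) hYm.aestronglyMeasurable
    hXm.aestronglyMeasurable
  have h4 : eLpNorm (X • Y) (j : ℝ≥0∞) μ ≤ ENNReal.ofReal (2 * a * b * j) := by
    refine (h3.trans (mul_le_mul' h1 h2)).trans_eq ?_
    rw [← ENNReal.ofReal_mul (by positivity)]
    congr 1
    have : √(2 * (j : ℝ)) * √(2 * j) = 2 * j := Real.mul_self_sqrt (by positivity)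
    linear_combination a * b * this
  have hj0 : j ≠ 0 := by omega
  rw [eLpNorm_eq_lintegral_rpow_enorm_toReal (by exact_mod_cast hj0) (by simp)] at h4
  have h5 := pow_le_pow_left' h4 j
  rw [← ENNReal.ofReal_pow (by positivity)] at h5
  refine le_trans (le_of_eq ?_) h5
  rw [← ENNReal.rpow_natCast, ← ENNReal.rpow_mul]
  simp [hj0]

end Moments

section Mgf

variable {Ω : Type*} [MeasurableSpace Ω] {μ : Measure Ω} [IsProbabilityMeasure μ]

theorem SubExpMoments.integrable_pow {X : Ω → ℝ} {K : ℝ} (h : SubExpMoments μ X K)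
    (hX : Measurable X) (j : ℕ) : Integrable (fun ω => X ω ^ j) μ := by
  rcases Nat.eq_zero_or_pos j with rfl | hj
  · simp
  · refine ⟨(hX.pow_const j).aestronglyMeasurable, ?_⟩
    simp only [HasFiniteIntegral, enorm_pow]
    exact (h j hj).trans_lt ENNReal.ofReal_lt_top

theorem SubExpMoments.integrable {X : Ω → ℝ} {K : ℝ} (h : SubExpMoments μ X K)
    (hX : Measurable X) : Integrable X μ := by
  simpa using h.integrable_pow hX 1

omit [IsProbabilityMeasure μ] in
theorem SubExpMoments.integral_abs_pow_le {X : Ω → ℝ} {K : ℝ} (hK : 0 ≤ K)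
    (h : SubExpMoments μ X K) (hX : Measurable X) {j : ℕ} (hj : 1 ≤ j) :
    ∫ ω, |X ω| ^ j ∂μ ≤ (K * j) ^ j := by
  rw [integral_eq_lintegral_of_nonneg_ae (ae_of_all _ fun ω => by positivity)
    (by fun_prop)]
  refine ENNReal.toReal_le_of_le_ofReal (by positivity) ?_
  refine le_trans (le_of_eq ?_) (h j hj)
  refine lintegral_congr fun ω => ?_
  rw [ENNReal.ofReal_pow (abs_nonneg _), Real.enorm_eq_ofReal_abs]

/-- The terms of the exponential series of a variable with sub-exponential moments are dominated
by a geometric series, since `j ^ j / j! ≤ e ^ j`. -/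
theorem SubExpMoments.integral_exp_term_le {X : Ω → ℝ} {K t : ℝ} (hK : 0 ≤ K)
    (h : SubExpMoments μ X K) (hX : Measurable X) (j : ℕ) :
    ∫ ω, ‖(t * X ω) ^ j / (j.factorial : ℝ)‖ ∂μ ≤ (Real.exp 1 * |t| * K) ^ j := by
  rcases Nat.eq_zero_or_pos j with rfl | hj
  · simp
  · have e1 : ∀ ω, ‖(t * X ω) ^ j / (j.factorial : ℝ)‖
        = |t| ^ j / (j.factorial : ℝ) * |X ω| ^ j := by
      intro ω
      rw [Real.norm_eq_abs, abs_div, abs_pow, abs_mul, mul_pow, Nat.abs_cast]; ring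
    simp_rw [e1]
    rw [integral_const_mul]
    have h1 := h.integral_abs_pow_le hK hX hj
    have h2 : (j : ℝ) ^ j / (j.factorial : ℝ) ≤ Real.exp 1 ^ j := by
      rw [← Real.exp_nat_mul, mul_one]
      exact Real.pow_div_factorial_le_exp j (by positivity) j
    calc |t| ^ j / (j.factorial : ℝ) * ∫ ω, |X ω| ^ j ∂μ
        ≤ |t| ^ j / (j.factorial : ℝ) * (K * j) ^ j := by gcongr
      _ = |t| ^ j * K ^ j * ((j : ℝ) ^ j / (j.factorial : ℝ)) := by rw [mul_pow]; ring
      _ ≤ |t| ^ j * K ^ j * Real.exp 1 ^ j := by gcongr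
      _ = _ := by rw [mul_pow, mul_pow]; ring

theorem exp_eq_tsum_pow_div (x : ℝ) : Real.exp x = ∑' j : ℕ, x ^ j / (j.factorial : ℝ) := by
  rw [Real.exp_eq_exp_ℝ, NormedSpace.exp_eq_tsum_div]

theorem SubExpMoments.integrable_exp {X : Ω → ℝ} {K t : ℝ} (hK : 0 ≤ K)
    (h : SubExpMoments μ X K) (hX : Measurable X) (ht : Real.exp 1 * |t| * K < 1) :
    Integrable (fun ω => Real.exp (t * X ω)) μ := by
  have hq : 0 ≤ Real.exp 1 * |t| * K := by positivity
  refine ⟨by fun_prop, ?_⟩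
  have e1 : ∀ ω, ‖Real.exp (t * X ω)‖ₑ
      ≤ ∑' j : ℕ, ‖(t * X ω) ^ j / (j.factorial : ℝ)‖ₑ := by
    intro ω
    have hs : Summable fun j : ℕ => (t * X ω) ^ j / (j.factorial : ℝ) :=
      Real.summable_pow_div_factorial _
    rw [exp_eq_tsum_pow_div]
    exact enorm_tsum_le_tsum_enorm
  refine (lintegral_mono e1).trans_lt ?_
  rw [lintegral_tsum (fun j => by fun_prop)]
  have e2 : ∀ j : ℕ, ∫⁻ ω, ‖(t * X ω) ^ j / (j.factorial : ℝ)‖ₑ ∂μ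
      ≤ ENNReal.ofReal ((Real.exp 1 * |t| * K) ^ j) := by
    intro j
    rw [← ofReal_integral_norm_eq_lintegral_enorm]
    · exact ENNReal.ofReal_le_ofReal (h.integral_exp_term_le hK hX j)
    · simp_rw [mul_pow]
      exact ((h.integrable_pow hX j).const_mul _).div_const _
  refine (ENNReal.tsum_le_tsum e2).trans_lt ?_
  rw [← ENNReal.ofReal_tsum_of_nonneg (fun j => by positivity) (summable_geometric_of_lt_one hq ht)]
  exact ENNReal.ofReal_lt_top

/-- Bernstein-type bound on the moment generating function of a centered variable with
sub-exponential moments. The mean is subtracted only here, so no moments of `X - E X` are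
needed. -/
theorem SubExpMoments.integral_exp_centered_le {X : Ω → ℝ} {K t : ℝ} (hK : 0 ≤ K)
    (h : SubExpMoments μ X K) (hX : Measurable X) (ht : Real.exp 1 * |t| * K ≤ 1 / 2) :
    ∫ ω, Real.exp (t * (X ω - ∫ ω', X ω' ∂μ)) ∂μ
      ≤ Real.exp (2 * (Real.exp 1 * |t| * K) ^ 2) := by
  set q := Real.exp 1 * |t| * K with hq_def
  set M := ∫ ω', X ω' ∂μ
  have hq : 0 ≤ q := by positivity
  have hq1 : q < 1 := by linarith
  have hint : ∀ j : ℕ, Integrable (fun ω => (t * X ω) ^ j / (j.factorial : ℝ)) μ := by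
    intro j
    simp_rw [mul_pow]
    exact ((h.integrable_pow hX j).const_mul _).div_const _
  have hbound := fun j => h.integral_exp_term_le (t := t) hK hX j
  have hsum := hasSum_integral_of_summable_integral_norm hint
    (Summable.of_nonneg_of_le (fun j => by positivity) hbound (summable_geometric_of_lt_one hq hq1))
  simp_rw [← exp_eq_tsum_pow_div] at hsum
  have hterm : ∀ j : ℕ, ∫ ω, (t * X ω) ^ j / (j.factorial : ℝ) ∂μ ≤ q ^ j := fun j =>
    (le_abs_self _).trans ((norm_integral_le_integral_norm _).trans (hbound j))
  have hsum2 := (hasSum_nat_add_iff' 2).2 hsum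
  have hgeo : HasSum (fun j : ℕ => q ^ (j + 2)) ((1 - q)⁻¹ * q ^ 2) := by
    simp_rw [pow_add]
    exact (hasSum_geometric_of_lt_one hq hq1).mul_right (q ^ 2)
  have hle := hasSum_le (fun j => hterm (j + 2)) hsum2 hgeo
  have hlin : ∑ j ∈ Finset.range 2, ∫ ω, (t * X ω) ^ j / (j.factorial : ℝ) ∂μ = 1 + t * M := by
    simp [Finset.sum_range_succ, integral_const_mul, M]
  rw [hlin] at hle
  have hinv : (1 - q)⁻¹ ≤ 2 := by
    rw [inv_le_comm₀ (by linarith) (by norm_num)]; linarith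
  have hmain : ∫ ω, Real.exp (t * X ω) ∂μ ≤ Real.exp (t * M + 2 * q ^ 2) := by
    have h1 : ∫ ω, Real.exp (t * X ω) ∂μ ≤ (t * M + 2 * q ^ 2) + 1 := by
      nlinarith [mul_le_mul_of_nonneg_right hinv (sq_nonneg q)]
    exact h1.trans (Real.add_one_le_exp _)
  have e1 : ∀ ω, Real.exp (t * (X ω - M)) = Real.exp (-(t * M)) * Real.exp (t * X ω) := by
    intro ω; rw [← Real.exp_add]; ring_nf
  simp_rw [e1]
  rw [integral_const_mul]
  calc Real.exp (-(t * M)) * ∫ ω, Real.exp (t * X ω) ∂μ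
      ≤ Real.exp (-(t * M)) * Real.exp (t * M + 2 * q ^ 2) := by gcongr
    _ = _ := by rw [← Real.exp_add]; ring_nf

end Mgf

section SumMoments

/-- The scale of the `2k`-th moment norm of a sum of at most `N` independent centered variables
whose moments grow sub-exponentially with constant `1`. -/
noncomputable def sumScale (N k : ℝ) : ℝ := 22 * (√(N * k) + k)

theorem sumScale_nonneg {N k : ℝ} (hk : 0 ≤ k) : 0 ≤ sumScale N k := by
  unfold sumScale; positivity

theorem pow_even_le_exp_add_exp {t : ℝ} (ht : 0 < t) (x : ℝ) (k : ℕ) :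
    x ^ (2 * k) ≤ ((2 * k : ℕ) * t⁻¹) ^ (2 * k) * (Real.exp (t * x) + Real.exp (-t * x)) := by
  have h1 : |t * x| ^ (2 * k) / ((2 * k).factorial : ℝ) ≤ Real.exp |t * x| :=
    Real.pow_div_factorial_le_exp _ (abs_nonneg _) _
  have h2 : Real.exp |t * x| ≤ Real.exp (t * x) + Real.exp (-t * x) := by
    rcases abs_cases (t * x) with ⟨h, _⟩ | ⟨h, _⟩ <;> rw [h]
    · linarith [Real.exp_pos (-t * x)]
    · rw [neg_mul]; linarith [Real.exp_pos (t * x)]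
  have hf : ((2 * k).factorial : ℝ) ≤ ((2 * k : ℕ) : ℝ) ^ (2 * k) := by
    exact_mod_cast Nat.factorial_le_pow (2 * k)
  have hpos : (0 : ℝ) < ((2 * k).factorial : ℝ) := by positivity
  rw [div_le_iff₀ hpos, (even_two_mul k).pow_abs, mul_pow] at h1
  have h3 : x ^ (2 * k) = (t⁻¹) ^ (2 * k) * (t ^ (2 * k) * x ^ (2 * k)) := by
    rw [← mul_assoc, ← mul_pow, inv_mul_cancel₀ ht.ne', one_pow, one_mul]
  rw [h3, mul_pow]
  calc (t⁻¹) ^ (2 * k) * (t ^ (2 * k) * x ^ (2 * k))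
      ≤ (t⁻¹) ^ (2 * k) * (Real.exp |t * x| * ((2 * k).factorial : ℝ)) := by gcongr
    _ ≤ (t⁻¹) ^ (2 * k) *
          ((Real.exp (t * x) + Real.exp (-t * x)) * ((2 * k : ℕ) : ℝ) ^ (2 * k)) := by gcongr
    _ = _ := by ring

variable {α ι : Type*} [MeasurableSpace α] [Fintype ι] {μ : Measure α} [IsProbabilityMeasure μ]

theorem SubExpMoments.integrable_exp_sum {X : α → ℝ} {K t : ℝ} (hK : 0 ≤ K)
    (h : SubExpMoments μ X K) (hX : Measurable X) (ht : Real.exp 1 * |t| * K ≤ 1 / 2) (M : ℝ) :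
    Integrable (fun a : ι → α => Real.exp (t * ∑ i, (X (a i) - M)))
      (Measure.pi fun _ => μ) := by
  simp_rw [Finset.mul_sum, Real.exp_sum]
  refine Integrable.fintype_prod (f := fun (_ : ι) x => Real.exp (t * (X x - M))) fun _ => ?_
  have e1 : ∀ x, Real.exp (t * (X x - M)) = Real.exp (-(t * M)) * Real.exp (t * X x) := by
    intro ω; rw [← Real.exp_add]; ring_nf
  simp_rw [e1]
  exact (h.integrable_exp hK hX (by linarith)).const_mul _

theorem SubExpMoments.integral_exp_sum_le {X : α → ℝ} {K t : ℝ} (hK : 0 ≤ K)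
    (h : SubExpMoments μ X K) (hX : Measurable X) (ht : Real.exp 1 * |t| * K ≤ 1 / 2) :
    ∫ a : ι → α, Real.exp (t * ∑ i, (X (a i) - ∫ x, X x ∂μ)) ∂(Measure.pi fun _ => μ)
      ≤ Real.exp (2 * (Real.exp 1 * |t| * K) ^ 2 * Fintype.card ι) := by
  simp_rw [Finset.mul_sum, Real.exp_sum]
  rw [integral_fintype_prod_eq_prod (fun (_ : ι) y => Real.exp (t * (X y - ∫ x, X x ∂μ)))]
  rw [Finset.prod_const, mul_comm (2 * _) (_ : ℝ), Real.exp_nat_mul, Finset.card_univ]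
  exact pow_le_pow_left₀ (integral_nonneg fun _ => (Real.exp_pos _).le)
    (h.integral_exp_centered_le hK hX ht) _

theorem SubExpMoments.lintegral_sum_pow_le_of_pos {X : α → ℝ} {K : ℝ} (hK : 0 < K)
    (h : SubExpMoments μ X K) (hX : Measurable X) {N k : ℕ} (hN : 1 ≤ N) (hk : 1 ≤ k)
    (hcard : Fintype.card ι ≤ N) :
    ∫⁻ a : ι → α, ENNReal.ofReal ((∑ i, (X (a i) - ∫ x, X x ∂μ)) ^ (2 * k))
        ∂(Measure.pi fun _ => μ)
      ≤ ENNReal.ofReal ((sumScale N k * K) ^ (2 * k)) := by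
  set M := ∫ x, X x ∂μ with hM
  have hN' : (0 : ℝ) < N := by exact_mod_cast hN
  have hk' : (0 : ℝ) < k := by exact_mod_cast hk
  have hk1 : (1 : ℝ) ≤ k := by exact_mod_cast hk
  -- `r⁻¹` balances the sub-Gaussian range `√(k / N)` of the exponential moment against its cut-off
  set r : ℝ := √((N : ℝ) / k) + 1 with hr
  have hr0 : 0 < r := by positivity
  have hr1 : 1 ≤ r := by rw [hr]; linarith [Real.sqrt_nonneg ((N : ℝ) / k)]
  have hrN : N ≤ r ^ 2 * k := by
    have h1 : (N : ℝ) / k ≤ r ^ 2 := by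
      have := Real.sq_sqrt (show (0 : ℝ) ≤ N / k by positivity)
      have h2 := Real.sqrt_nonneg ((N : ℝ) / k)
      rw [hr]; nlinarith
    rwa [div_le_iff₀ hk'] at h1
  set t : ℝ := (2 * Real.exp 1 * K * r)⁻¹ with htdef
  have he : 0 < Real.exp 1 := Real.exp_pos 1
  have ht : 0 < t := by positivity
  have hq : Real.exp 1 * |t| * K = (2 * r)⁻¹ := by
    rw [abs_of_pos ht, htdef]; field_simp
  have hq2 : Real.exp 1 * |t| * K ≤ 1 / 2 := by
    rw [hq, mul_inv]
    have := inv_le_one_of_one_le₀ hr1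
    linarith
  have hq' : Real.exp 1 * |-t| * K ≤ 1 / 2 := by rwa [abs_neg]
  have hexp : Real.exp (2 * (Real.exp 1 * |t| * K) ^ 2 * Fintype.card ι) ≤ Real.exp (k / 2) := by
    apply Real.exp_le_exp.2
    rw [hq]
    have hc : (Fintype.card ι : ℝ) ≤ N := by exact_mod_cast hcard
    calc 2 * (2 * r)⁻¹ ^ 2 * (Fintype.card ι : ℝ) ≤ 2 * (2 * r)⁻¹ ^ 2 * (r ^ 2 * k) := by
          gcongr; exact hc.trans hrN
      _ = (k : ℝ) / 2 := by field_simp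
  have i1 := h.integrable_exp_sum (ι := ι) hK.le hX hq2 M
  have i2 := h.integrable_exp_sum (ι := ι) hK.le hX hq' M
  have b1 := h.integral_exp_sum_le (ι := ι) hK.le hX hq2
  have b2 := h.integral_exp_sum_le (ι := ι) hK.le hX hq'
  rw [abs_neg] at b2
  set c : ℝ := ((2 * k : ℕ) * t⁻¹) ^ (2 * k) with hc
  have hc0 : 0 ≤ c := by positivity
  calc ∫⁻ a : ι → α, ENNReal.ofReal ((∑ i, (X (a i) - M)) ^ (2 * k)) ∂(Measure.pi fun _ => μ)
      ≤ ∫⁻ a : ι → α, ENNReal.ofReal (c * (Real.exp (t * ∑ i, (X (a i) - M))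
          + Real.exp (-t * ∑ i, (X (a i) - M)))) ∂(Measure.pi fun _ => μ) :=
        lintegral_mono fun a => ENNReal.ofReal_le_ofReal (pow_even_le_exp_add_exp ht _ k)
    _ = ENNReal.ofReal (∫ a : ι → α, c * (Real.exp (t * ∑ i, (X (a i) - M))
          + Real.exp (-t * ∑ i, (X (a i) - M))) ∂(Measure.pi fun _ => μ)) := by
        exact (ofReal_integral_eq_lintegral_ofReal ((i1.add i2).const_mul c)
          (ae_of_all _ fun a => mul_nonneg hc0
            (add_nonneg (Real.exp_pos _).le (Real.exp_pos _).le))).symm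
    _ ≤ ENNReal.ofReal (c * (2 * Real.exp (k / 2))) := by
        apply ENNReal.ofReal_le_ofReal
        rw [integral_const_mul, integral_add i1 i2]
        gcongr
        linarith
    _ ≤ _ := by
        apply ENNReal.ofReal_le_ofReal
        have e1 : Real.exp (k / 2) ≤ 2 ^ k := by
          have h1 : Real.exp (1 / 2) ≤ 2 := by
            have h2 : Real.exp (1 / 2) ^ 2 ≤ 2 ^ 2 := by
              rw [← Real.exp_nat_mul]; norm_num; linarith [Real.exp_one_lt_d9]
            exact le_of_sq_le_sq h2 (by norm_num)
          calc Real.exp (k / 2) = Real.exp (1 / 2) ^ k := by rw [← Real.exp_nat_mul]; ring_nf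
            _ ≤ 2 ^ k := by gcongr
        have e2 : 2 * Real.exp (k / 2) ≤ 2 ^ (2 * k) := by
          have h1 : (2 : ℝ) ≤ 2 ^ k := by
            calc (2 : ℝ) = 2 ^ 1 := by norm_num
              _ ≤ 2 ^ k := pow_le_pow_right₀ (by norm_num) hk
          calc 2 * Real.exp (k / 2) ≤ 2 ^ k * 2 ^ k := by gcongr
            _ = 2 ^ (2 * k) := by rw [two_mul, pow_add]
        have e3 : (2 * k : ℕ) * t⁻¹ * 2 ≤ sumScale N k * K := by
          have h1 : √((N : ℝ) / k) * k = √(N * k) := by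
            rw [show (N : ℝ) * k = N / k * (k * k) by field_simp, Real.sqrt_mul (by positivity),
              Real.sqrt_mul_self hk'.le]
          have h2 : (2 * k : ℕ) * t⁻¹ * 2 = 8 * Real.exp 1 * (√(N * k) + k) * K := by
            rw [htdef, inv_inv, ← h1, hr]; push_cast; ring
          rw [h2, sumScale]
          gcongr
          linarith [Real.exp_one_lt_d9]
        calc c * (2 * Real.exp (k / 2)) ≤ c * 2 ^ (2 * k) := by gcongr
          _ = ((2 * k : ℕ) * t⁻¹ * 2) ^ (2 * k) := by rw [hc, ← mul_pow]
          _ ≤ _ := by gcongr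

/-- Moments of a sum of independent centered variables with sub-exponential moments: the
`2k`-th moment norm is of order `K (√(N k) + k)`. -/
theorem SubExpMoments.lintegral_sum_pow_le {X : α → ℝ} {K : ℝ} (hK : 0 ≤ K)
    (h : SubExpMoments μ X K) (hX : Measurable X) {N k : ℕ} (hN : 1 ≤ N) (hk : 1 ≤ k)
    (hcard : Fintype.card ι ≤ N) :
    ∫⁻ a : ι → α, ENNReal.ofReal ((∑ i, (X (a i) - ∫ x, X x ∂μ)) ^ (2 * k))
        ∂(Measure.pi fun _ => μ)
      ≤ ENNReal.ofReal ((sumScale N k * K) ^ (2 * k)) := by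
  -- the case `K = 0` follows by letting the constant decrease to `K`
  have hcont : Continuous fun K' : ℝ => ENNReal.ofReal ((sumScale N k * K') ^ (2 * k)) :=
    ENNReal.continuous_ofReal.comp (by fun_prop)
  refine ge_of_tendsto ((hcont.tendsto K).mono_left nhdsWithin_le_nhds)
    (Filter.eventually_of_mem (self_mem_nhdsWithin (s := Set.Ioi K)) fun K' hK' => ?_)
  exact (h.mono hK (le_of_lt hK')).lintegral_sum_pow_le_of_pos (hK.trans_lt hK') hX hN hk hcard

omit [IsProbabilityMeasure μ] in
/-- Markov's inequality for an even moment: exceeding the moment norm by a factor `e` has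
probability at most `e ^ (-2k)`. -/
theorem measure_lt_abs_le_of_lintegral_pow_le {f : α → ℝ} (hf : Measurable f) {b : ℝ}
    (hb : 0 ≤ b) {k : ℕ} (hk : 1 ≤ k)
    (h : ∫⁻ a, ENNReal.ofReal (f a ^ (2 * k)) ∂μ ≤ ENNReal.ofReal (b ^ (2 * k))) :
    μ {a | Real.exp 1 * b < |f a|} ≤ ENNReal.ofReal (Real.exp (-(2 * k))) := by
  have hmeas : Measurable fun a => ENNReal.ofReal (f a ^ (2 * k)) := by fun_prop
  rcases hb.eq_or_lt with rfl | hb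
  · have h0 : ∫⁻ a, ENNReal.ofReal (f a ^ (2 * k)) ∂μ = 0 := by
      have : (0 : ℝ) ^ (2 * k) = 0 := zero_pow (by omega)
      simpa [this] using h
    rw [lintegral_eq_zero_iff hmeas] at h0
    have : μ {a | Real.exp 1 * 0 < |f a|} = 0 := by
      refine measure_mono_null (fun a ha => ?_) h0
      simp only [mul_zero, Set.mem_ofPred_eq, abs_pos] at ha
      have : 0 < f a ^ (2 * k) := (even_two_mul k).pow_pos ha
      simpa using this
    rw [this]; exact zero_le
  · have hpos : 0 < (Real.exp 1 * b) ^ (2 * k) := by positivity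
    have h1 := mul_meas_ge_le_lintegral₀ (μ := μ) hmeas.aemeasurable
      (ENNReal.ofReal ((Real.exp 1 * b) ^ (2 * k)))
    have h2 : μ {a | Real.exp 1 * b < |f a|}
        ≤ μ {a | ENNReal.ofReal ((Real.exp 1 * b) ^ (2 * k)) ≤ ENNReal.ofReal (f a ^ (2 * k))} := by
      refine measure_mono fun a ha => ENNReal.ofReal_le_ofReal ?_
      rw [← (even_two_mul k).pow_abs (f a)]
      have : Real.exp 1 * b < |f a| := ha
      gcongr
    have h3 := h1.trans h
    rw [mul_comm, ← ENNReal.le_div_iff_mul_le (Or.inl (by simpa using hpos)) (Or.inl (by simp)),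
      ← ENNReal.ofReal_div_of_pos hpos] at h3
    refine h2.trans (h3.trans (ENNReal.ofReal_le_ofReal (le_of_eq ?_)))
    rw [mul_pow, ← Real.exp_nat_mul, Real.exp_neg]
    field_simp
    push_cast
    ring_nf

end SumMoments

/-! ### Empirical second moments in operator norm -/


section Net

variable {E : Type*} [NormedAddCommGroup E] [InnerProductSpace ℝ E] [FiniteDimensional ℝ E]

/-- A maximal `1`-separated subset of the ball of radius `2` is a net of at most `5 ^ dim`
points. -/
theorem exists_finset_net (E : Type*) [NormedAddCommGroup E] [InnerProductSpace ℝ E]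
    [FiniteDimensional ℝ E] :
    ∃ s : Finset E, s.card ≤ 5 ^ Module.finrank ℝ E ∧ (∀ c ∈ s, ‖c‖ ≤ 2) ∧
      ∀ x : E, ‖x‖ ≤ 2 → ∃ c ∈ s, ‖x - c‖ ≤ 1 := by
  classical
  let A : Set ℕ := {l | ∃ s : Finset E, s.card = l ∧ (∀ c ∈ s, ‖c‖ ≤ 2) ∧
    ∀ c ∈ s, ∀ d ∈ s, c ≠ d → 1 ≤ ‖c - d‖}
  have hne : A.Nonempty := ⟨0, ∅, by simp⟩
  have hbdd : BddAbove A := by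
    refine ⟨5 ^ Module.finrank ℝ E, ?_⟩
    rintro _ ⟨s, rfl, h1, h2⟩
    exact Besicovitch.card_le_of_separated s h1 h2
  obtain ⟨s, hcard, h1, h2⟩ := Nat.sSup_mem hne hbdd
  refine ⟨s, Besicovitch.card_le_of_separated s h1 h2, h1, fun x hx => ?_⟩
  by_contra! hfar
  have hxs : x ∉ s := fun h => by simpa using (hfar x h).trans_le' zero_le_one
  have hmem : s.card + 1 ∈ A := by
    refine ⟨insert x s, Finset.card_insert_of_notMem hxs, ?_, ?_⟩
    · intro c hc
      rcases Finset.mem_insert.1 hc with rfl | hc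
      exacts [hx, h1 c hc]
    · intro c hc d hd hcd
      rcases Finset.mem_insert.1 hc with rfl | hc <;> rcases Finset.mem_insert.1 hd with rfl | hd
      · exact absurd rfl hcd
      · exact (hfar d hd).le
      · rw [norm_sub_rev]; exact (hfar c (by assumption)).le
      · exact h2 c hc d hd hcd
  have := le_csSup hbdd hmem
  omega

omit [FiniteDimensional ℝ E] in
theorem norm_le_of_forall_net {s : Finset E}
    (hs : ∀ x : E, ‖x‖ ≤ 2 → ∃ c ∈ s, ‖x - c‖ ≤ 1) {w : E} {η : ℝ} (hη : 0 ≤ η)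
    (h : ∀ u ∈ s, |inner ℝ u w| ≤ η) : ‖w‖ ≤ η := by
  rcases eq_or_ne w 0 with rfl | hw
  · simpa using hη
  have hw' : 0 < ‖w‖ := norm_pos_iff.2 hw
  obtain ⟨c, hc, hxc⟩ := hs ((2 / ‖w‖) • w) (by
    rw [norm_smul, Real.norm_of_nonneg (by positivity), div_mul_cancel₀ _ hw'.ne'])
  have h1 : inner ℝ ((2 / ‖w‖) • w) w = 2 * ‖w‖ := by
    rw [real_inner_smul_left, real_inner_self_eq_norm_sq]; field_simp
  have h2 : inner ℝ ((2 / ‖w‖) • w) w = inner ℝ c w + inner ℝ ((2 / ‖w‖) • w - c) w := by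
    rw [← inner_add_left, add_sub_cancel]
  have h3 := real_inner_le_norm ((2 / ‖w‖) • w - c) w
  have h4 := (le_abs_self _).trans (h c hc)
  have h5 : ‖(2 / ‖w‖) • w - c‖ * ‖w‖ ≤ 1 * ‖w‖ := by gcongr
  linarith

omit [FiniteDimensional ℝ E] in
/-- The operator norm is controlled by the bilinear form on a `1`-net of the ball of radius `2`;
the radius is chosen so that no constant is lost. -/
theorem opNorm_le_of_forall_net {s : Finset E}
    (hs : ∀ x : E, ‖x‖ ≤ 2 → ∃ c ∈ s, ‖x - c‖ ≤ 1) {T : E →L[ℝ] E} {η : ℝ} (hη : 0 ≤ η)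
    (h : ∀ u ∈ s, ∀ v ∈ s, |inner ℝ u (T v)| ≤ η) : ‖T‖ ≤ η := by
  have h1 : ∀ v ∈ s, ‖T v‖ ≤ η := fun v hv =>
    norm_le_of_forall_net hs hη fun u hu => h u hu v hv
  have h2 : ‖T‖ ≤ (η + ‖T‖) / 2 := by
    refine ContinuousLinearMap.opNorm_le_of_unit_norm (𝕜 := ℝ) (by positivity) fun x hx => ?_
    obtain ⟨c, hc, hxc⟩ := hs ((2 : ℝ) • x) (by rw [norm_smul, hx]; norm_num)
    have h3 : (2 : ℝ) • T x = T c + T ((2 : ℝ) • x - c) := by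
      rw [← map_add, add_sub_cancel, map_smul]
    have h4 : ‖(2 : ℝ) • T x‖ ≤ η + ‖T‖ * 1 := by
      rw [h3]
      refine (norm_add_le _ _).trans (add_le_add (h1 c hc) ((T.le_opNorm _).trans ?_))
      gcongr
    rw [norm_smul, Real.norm_ofNat] at h4
    linarith
  linarith

end Net

section Covariance

variable {Ω ι : Type*} [MeasurableSpace Ω] [Fintype ι] {P : Measure Ω}

theorem IsSubGVec.isSubG_inner {x : Ω → EuclideanSpace ℝ ι} {τ : ℝ} (h : IsSubGVec P x τ)
    (u : EuclideanSpace ℝ ι) : IsSubG P (fun ω => inner ℝ u (x ω)) (‖u‖ * τ) := by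
  intro p hp
  rcases eq_or_ne u 0 with rfl | hu
  · simp
  have hu' : 0 < ‖u‖ := norm_pos_iff.2 hu
  have h1 := h (‖u‖⁻¹ • u) (by
    rw [norm_smul, norm_inv, norm_norm, inv_mul_cancel₀ hu'.ne']) p hp
  have h2 : (fun ω => inner ℝ u (x ω))
      = ‖u‖ • fun ω => inner ℝ (‖u‖⁻¹ • u) (x ω) := by
    funext ω
    simp only [Pi.smul_apply, real_inner_smul_left, smul_eq_mul]
    field_simp
  rw [h2, eLpNorm_const_smul, mul_assoc, ENNReal.ofReal_mul hu'.le, enorm_norm,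
    ← ofReal_norm]
  gcongr

/-- All one-dimensional products `⟨u, x⟩ ⟨v, x⟩` have sub-exponential moments. -/
theorem IsSubGVec.inner_mul_inner {x : Ω → EuclideanSpace ℝ ι} {τ : ℝ} (h : IsSubGVec P x τ)
    (hx : Measurable x) (hτ : 0 ≤ τ) (u v : EuclideanSpace ℝ ι) :
    SubExpMoments P (fun ω => inner ℝ u (x ω) * inner ℝ v (x ω))
      (2 * (‖u‖ * τ) * (‖v‖ * τ)) :=
  (h.isSubG_inner u).mul (h.isSubG_inner v) (by positivity) (by positivity) (by fun_prop)
    (by fun_prop)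

variable [DecidableEq ι]

/-- The operator on Euclidean space given by a matrix. -/
noncomputable abbrev matOp (A : Matrix ι ι ℝ) : EuclideanSpace ℝ ι →L[ℝ] EuclideanSpace ℝ ι :=
  Matrix.toEuclideanCLM (𝕜 := ℝ) A

theorem inner_matOp_empSecondMoment {m : ℕ} (u : Fin m → EuclideanSpace ℝ ι)
    (a b : EuclideanSpace ℝ ι) :
    inner ℝ a (matOp (empSecondMoment u) b)
      = (m : ℝ)⁻¹ * ∑ t, inner ℝ a (u t) * inner ℝ b (u t) := by
  rw [Matrix.inner_toEuclideanCLM, empSecondMoment, Matrix.smul_mulVec, dotProduct_smul,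
    Matrix.sum_mulVec, dotProduct_sum, smul_eq_mul]
  congr 1
  refine Finset.sum_congr rfl fun t _ => ?_
  rw [Matrix.vecMulVec_mulVec]
  simp only [EuclideanSpace.inner_eq_star_dotProduct, star_trivial, dotProduct_smul,
    op_smul_eq_smul, smul_eq_mul]
  rw [dotProduct_comm (u t).ofLp a.ofLp, mul_comm]

theorem inner_matOp_secondMoment {x : Ω → EuclideanSpace ℝ ι}
    (hx : ∀ i j, Integrable (fun ω => x ω i * x ω j) P) (a b : EuclideanSpace ℝ ι) :
    inner ℝ a (matOp (secondMoment P x) b)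
      = ∫ ω, inner ℝ a (x ω) * inner ℝ b (x ω) ∂P := by
  have h1 : ∀ ω, inner ℝ a (x ω) * inner ℝ b (x ω)
      = ∑ i, ∑ j, a i * b j * (x ω i * x ω j) := by
    intro ω
    simp only [PiLp.inner_apply, RCLike.inner_apply, conj_trivial]
    rw [Finset.sum_mul_sum]
    refine Finset.sum_congr rfl fun i _ => Finset.sum_congr rfl fun j _ => by ring
  simp_rw [h1]
  rw [integral_finsetSum _ fun i _ => integrable_finsetSum _ fun j _ => (hx i j).const_mul _]
  rw [Matrix.inner_toEuclideanCLM]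
  simp only [dotProduct, Matrix.mulVec]
  refine Finset.sum_congr rfl fun i _ => ?_
  rw [integral_finsetSum _ fun j _ => (hx i j).const_mul _, Finset.mul_sum]
  refine Finset.sum_congr rfl fun j _ => ?_
  rw [integral_const_mul, secondMoment, Matrix.of_apply]; ring

theorem IsSubGVec.integrable_coord_mul [IsProbabilityMeasure P] {x : Ω → EuclideanSpace ℝ ι}
    {τ : ℝ} (h : IsSubGVec P x τ) (hx : Measurable x) (hτ : 0 ≤ τ) (i j : ι) :
    Integrable (fun ω => x ω i * x ω j) P := by
  have := (h.inner_mul_inner hx hτ (EuclideanSpace.single i 1)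
    (EuclideanSpace.single j 1)).integrable (by fun_prop)
  simpa [EuclideanSpace.inner_single_left] using this

theorem emp_sub_secondMoment_inner [IsProbabilityMeasure P] {x : Ω → EuclideanSpace ℝ ι}
    (hx : ∀ i j, Integrable (fun ω => x ω i * x ω j) P) {m : ℕ} (hm : 1 ≤ m)
    (w : Fin m → Ω) (a b : EuclideanSpace ℝ ι) :
    inner ℝ a ((matOp (empSecondMoment fun t => x (w t)) - matOp (secondMoment P x)) b)
      = (m : ℝ)⁻¹ * ∑ t, (inner ℝ a (x (w t)) * inner ℝ b (x (w t))
          - ∫ ω, inner ℝ a (x ω) * inner ℝ b (x ω) ∂P) := by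
  have hm' : (m : ℝ) ≠ 0 := by positivity
  rw [_root_.sub_apply, inner_sub_right, inner_matOp_empSecondMoment,
    inner_matOp_secondMoment hx, Finset.sum_sub_distrib, Finset.sum_const, Finset.card_univ,
    Fintype.card_fin, nsmul_eq_mul]
  field_simp

/-- Concentration of the empirical second moment matrix of a sub-Gaussian vector in operator
norm, by a union bound over pairs of points of a net. -/
theorem IsSubGVec.measure_opNorm_emp_sub_gt_le [IsProbabilityMeasure P]
    {x : Ω → EuclideanSpace ℝ ι} {τ : ℝ} (h : IsSubGVec P x τ) (hx : Measurable x) (hτ : 0 ≤ τ)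
    {m k : ℕ} (hm : 1 ≤ m) (hk : 1 ≤ k) :
    (Measure.pi fun _ : Fin m => P)
        {w | ¬ ‖matOp (empSecondMoment fun t => x (w t)) - matOp (secondMoment P x)‖
          ≤ (m : ℝ)⁻¹ * (Real.exp 1 * (sumScale m k * (8 * τ ^ 2)))}
      ≤ ENNReal.ofReal (25 ^ Fintype.card ι * Real.exp (-(2 * k))) := by
  obtain ⟨s, hs1, hs2, hs3⟩ := exists_finset_net (EuclideanSpace ℝ ι)
  have hm' : (0 : ℝ) < m := by positivity
  set b : ℝ := sumScale m k * (8 * τ ^ 2) with hb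
  have hb0 : 0 ≤ b := mul_nonneg (sumScale_nonneg (by positivity)) (by positivity)
  have hint := h.integrable_coord_mul hx hτ
  let f : EuclideanSpace ℝ ι × EuclideanSpace ℝ ι → (Fin m → Ω) → ℝ := fun q w =>
    ∑ t, (inner ℝ q.1 (x (w t)) * inner ℝ q.2 (x (w t))
          - ∫ ω, inner ℝ q.1 (x ω) * inner ℝ q.2 (x ω) ∂P)
  have hsub : {w : Fin m → Ω |
        ¬ ‖matOp (empSecondMoment fun t => x (w t)) - matOp (secondMoment P x)‖
          ≤ (m : ℝ)⁻¹ * (Real.exp 1 * b)}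
      ⊆ ⋃ q ∈ s ×ˢ s, {w | Real.exp 1 * b < |f q w|} := by
    intro w hw
    by_contra hcon
    simp only [Set.mem_iUnion, Set.mem_ofPred_eq, not_exists, not_lt] at hcon
    refine hw (opNorm_le_of_forall_net hs3 (by positivity) fun u hu v hv => ?_)
    rw [emp_sub_secondMoment_inner hint hm, abs_mul, abs_of_pos (inv_pos.2 hm')]
    gcongr
    exact hcon (u, v) (Finset.mk_mem_product hu hv)
  have hone : ∀ q ∈ s ×ˢ s, (Measure.pi fun _ : Fin m => P) {w | Real.exp 1 * b < |f q w|}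
      ≤ ENNReal.ofReal (Real.exp (-(2 * k))) := by
    rintro ⟨u, v⟩ hq
    obtain ⟨hu, hv⟩ := Finset.mem_product.1 hq
    have hu2 : ‖u‖ ≤ 2 := hs2 u hu
    have hv2 : ‖v‖ ≤ 2 := hs2 v hv
    have hsub := (h.inner_mul_inner hx hτ u v).mono (b := 8 * τ ^ 2) (by positivity) (by
      calc 2 * (‖u‖ * τ) * (‖v‖ * τ) ≤ 2 * (2 * τ) * (2 * τ) := by gcongr
        _ = _ := by ring)
    exact measure_lt_abs_le_of_lintegral_pow_le (by fun_prop) hb0 hk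
      (hsub.lintegral_sum_pow_le (by positivity) (by fun_prop) hm hk (by simp))
  refine (measure_mono hsub).trans ((measure_biUnion_finset_le _ _).trans
    ((Finset.sum_le_sum hone).trans ?_))
  rw [Finset.sum_const, nsmul_eq_mul, ENNReal.ofReal_mul (by positivity), Finset.card_product]
  gcongr
  rw [← ENNReal.ofReal_natCast]
  apply ENNReal.ofReal_le_ofReal
  rw [finrank_euclideanSpace] at hs1
  have : s.card * s.card ≤ 25 ^ Fintype.card ι := by
    calc s.card * s.card ≤ 5 ^ Fintype.card ι * 5 ^ Fintype.card ι := Nat.mul_le_mul hs1 hs1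
      _ = 25 ^ Fintype.card ι := by rw [← mul_pow]; norm_num
  exact_mod_cast this

end Covariance

/-! ### Decoupling and concentration of U-statistics -/


section Decoupling

variable {ι : Type*} [Fintype ι] [DecidableEq ι]

theorem four_mul_card_mem_notMem {i j : ι} (hij : i ≠ j) :
    4 * (Finset.univ.filter fun I : Finset ι => i ∈ I ∧ j ∉ I).card = 2 ^ Fintype.card ι := by
  have h1 : (Finset.univ.filter fun I : Finset ι => i ∈ I ∧ j ∉ I)
      = Finset.Icc {i} (Finset.univ.erase j) := by
    ext I
    simp [Finset.subset_erase]
  have h2 : 2 ≤ Fintype.card ι := by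
    have := Finset.card_le_univ ({i, j} : Finset ι)
    rwa [Finset.card_pair hij] at this
  rw [h1, Finset.card_Icc_finset (by simpa using hij), Finset.card_singleton,
    Finset.card_erase_of_mem (Finset.mem_univ j), Finset.card_univ]
  obtain ⟨l, hl⟩ := Nat.exists_eq_add_of_le h2
  rw [hl, show 2 + l - 1 - 1 = l by omega, pow_add]
  norm_num

/-- Decoupling identity: an off-diagonal double sum is four times its average over all splittings
of the index set, the rows being taken from `I` and the columns from the complement. -/
theorem sum_offDiag_eq_decoupled (f : ι → ι → ℝ) :
    ∑ i, ∑ j, (if i ≠ j then f i j else 0)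
      = ∑ I : Finset ι, (2 ^ Fintype.card ι : ℝ)⁻¹ * (4 * ∑ i ∈ I, ∑ j ∈ Iᶜ, f i j) := by
  have h1 : ∀ I : Finset ι, ∑ i ∈ I, ∑ j ∈ Iᶜ, f i j
      = ∑ i, ∑ j, if i ∈ I ∧ j ∉ I then f i j else 0 := by
    intro I
    trans ∑ i, if i ∈ I then ∑ j ∈ Iᶜ, f i j else 0
    · simp
    refine Finset.sum_congr rfl fun i _ => ?_
    by_cases hi : i ∈ I
    · simp only [hi, true_and, if_true]
      rw [← Finset.sum_filter]
      congr 1; ext j; simp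
    · simp [hi]
  have h2 : ∑ I : Finset ι, ∑ i, ∑ j, (if i ∈ I ∧ j ∉ I then f i j else 0)
      = ∑ i, ∑ j, ∑ I : Finset ι, if i ∈ I ∧ j ∉ I then f i j else 0 := by
    rw [Finset.sum_comm]
    exact Finset.sum_congr rfl fun i _ => Finset.sum_comm
  rw [← Finset.mul_sum, ← Finset.mul_sum, Finset.sum_congr rfl fun I _ => h1 I, h2]
  simp_rw [Finset.mul_sum]
  refine Finset.sum_congr rfl fun i _ => Finset.sum_congr rfl fun j _ => ?_
  rw [← Finset.mul_sum, ← Finset.mul_sum]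
  rw [← Finset.sum_filter, Finset.sum_const, nsmul_eq_mul]
  split_ifs with h
  · have := four_mul_card_mem_notMem h
    have h2 : (4 : ℝ) * ((Finset.univ.filter fun I : Finset ι => i ∈ I ∧ j ∉ I).card : ℝ)
        = 2 ^ Fintype.card ι := by exact_mod_cast this
    rw [← mul_assoc 4, h2, inv_mul_cancel_left₀ (by positivity)]
  · have : i = j := not_not.1 h
    subst this
    simp

/-- Jensen's inequality for the decoupling identity. -/
theorem pow_sum_offDiag_le (f : ι → ι → ℝ) (k : ℕ) :
    (∑ i, ∑ j, (if i ≠ j then f i j else 0)) ^ (2 * k)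
      ≤ ∑ I : Finset ι, (2 ^ Fintype.card ι : ℝ)⁻¹ *
          (4 * ∑ i ∈ I, ∑ j ∈ Iᶜ, f i j) ^ (2 * k) := by
  rw [sum_offDiag_eq_decoupled]
  refine Real.pow_arith_mean_le_arith_mean_pow_of_even _ _ _ (fun _ _ => by positivity) ?_
    (even_two_mul k)
  rw [Finset.sum_const, Finset.card_univ, Fintype.card_finset, nsmul_eq_mul]
  push_cast
  exact mul_inv_cancel₀ (by positivity)

end Decoupling

section VectorSums

variable {α ι E : Type*} [MeasurableSpace α] [Fintype ι] {μ : Measure α} [IsProbabilityMeasure μ]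
  [NormedAddCommGroup E] [InnerProductSpace ℝ E] [FiniteDimensional ℝ E] [MeasurableSpace E]
  [BorelSpace E] {Z : α → E} {b : E} {K : ℝ}

/-- The random vector `Z` has mean `b`, and each of its one-dimensional marginals `⟨θ, Z⟩` has
sub-exponential moments with constant `K ‖θ‖`. -/
structure SubExpVec (μ : Measure α) (Z : α → E) (b : E) (K : ℝ) : Prop where
  measurable : Measurable Z
  nonneg : 0 ≤ K
  moments : ∀ θ : E, SubExpMoments μ (fun a => inner ℝ θ (Z a)) (K * ‖θ‖)
  mean : ∀ θ : E, ∫ a, inner ℝ θ (Z a) ∂μ = inner ℝ θ b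

/-- The centered sum `∑ᵢ (Z(aᵢ) - b)`. -/
def centeredSum (Z : α → E) (b : E) (a : ι → α) : E := ∑ i, (Z (a i) - b)

omit [IsProbabilityMeasure μ] [FiniteDimensional ℝ E] in
theorem SubExpVec.measurable_centeredSum [SecondCountableTopology E] (h : SubExpVec μ Z b K) :
    Measurable (centeredSum (ι := ι) Z b) := by
  have := h.measurable
  unfold centeredSum
  fun_prop

omit [FiniteDimensional ℝ E] in
theorem SubExpVec.lintegral_inner_pow_le [SecondCountableTopology E]
    (h : SubExpVec μ Z b K) {N k : ℕ} (hN : 1 ≤ N)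
    (hk : 1 ≤ k) (hcard : Fintype.card ι ≤ N) (θ : E) :
    ∫⁻ a : ι → α, ENNReal.ofReal (inner ℝ θ (centeredSum Z b a) ^ (2 * k))
        ∂(Measure.pi fun _ => μ)
      ≤ ENNReal.ofReal ((sumScale N k * (K * ‖θ‖)) ^ (2 * k)) := by
  have hZ := h.measurable
  have := (h.moments θ).lintegral_sum_pow_le (ι := ι)
    (mul_nonneg h.nonneg (norm_nonneg θ)) (by fun_prop) hN hk hcard
  simpa only [h.mean θ, ← inner_sub_right, ← inner_sum, centeredSum] using this

omit [MeasurableSpace E] [BorelSpace E] in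
theorem norm_pow_le_sum_inner_pow (v : E) {k : ℕ} (hk : 1 ≤ k) :
    ‖v‖ ^ (2 * k) ≤ ∑ i, (Module.finrank ℝ E : ℝ) ^ (k - 1)
      * inner ℝ (stdOrthonormalBasis ℝ E i) v ^ (2 * k) := by
  obtain ⟨l, rfl⟩ := Nat.exists_eq_add_of_le' hk
  rw [pow_mul, ← (stdOrthonormalBasis ℝ E).sum_sq_inner_right v, ← Finset.mul_sum]
  simp_rw [pow_mul]
  rcases Nat.eq_zero_or_pos (Module.finrank ℝ E) with h0 | hpos
  · have : IsEmpty (Fin (Module.finrank ℝ E)) := by rw [h0]; infer_instance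
    simp
  have := pow_sum_div_card_le_sum_pow (s := Finset.univ)
    (f := fun i => inner ℝ (stdOrthonormalBasis ℝ E i) v ^ 2) (fun i _ => by positivity) l
  rw [Finset.card_univ, Fintype.card_fin, div_le_iff₀ (by positivity)] at this
  rw [Nat.add_sub_cancel, mul_comm]
  exact this

theorem SubExpVec.lintegral_norm_pow_le (h : SubExpVec μ Z b K) {N k : ℕ} (hN : 1 ≤ N)
    (hk : 1 ≤ k) (hcard : Fintype.card ι ≤ N) :
    ∫⁻ a : ι → α, ENNReal.ofReal (‖centeredSum Z b a‖ ^ (2 * k)) ∂(Measure.pi fun _ => μ)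
      ≤ ENNReal.ofReal ((√(Module.finrank ℝ E) * (sumScale N k * K)) ^ (2 * k)) := by
  set d := Module.finrank ℝ E
  have hm := h.measurable_centeredSum (ι := ι)
  calc ∫⁻ a : ι → α, ENNReal.ofReal (‖centeredSum Z b a‖ ^ (2 * k)) ∂(Measure.pi fun _ => μ)
      ≤ ∫⁻ a : ι → α, ∑ i, ENNReal.ofReal ((d : ℝ) ^ (k - 1))
          * ENNReal.ofReal (inner ℝ (stdOrthonormalBasis ℝ E i) (centeredSum Z b a) ^ (2 * k))
          ∂(Measure.pi fun _ => μ) := by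
        refine lintegral_mono fun a => ?_
        refine (ENNReal.ofReal_le_ofReal (norm_pow_le_sum_inner_pow _ hk)).trans_eq ?_
        rw [ENNReal.ofReal_sum_of_nonneg
          (fun i _ => mul_nonneg (by positivity) ((even_two_mul k).pow_nonneg _))]
        exact Finset.sum_congr rfl fun i _ => ENNReal.ofReal_mul (by positivity)
    _ = ∑ i, ENNReal.ofReal ((d : ℝ) ^ (k - 1)) * ∫⁻ a : ι → α,
          ENNReal.ofReal (inner ℝ (stdOrthonormalBasis ℝ E i) (centeredSum Z b a) ^ (2 * k))
          ∂(Measure.pi fun _ => μ) := by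
        rw [lintegral_finsetSum _ (fun i _ => by fun_prop)]
        exact Finset.sum_congr rfl fun i _ => lintegral_const_mul _ (by fun_prop)
    _ ≤ ∑ _i : Fin d, ENNReal.ofReal ((d : ℝ) ^ (k - 1))
          * ENNReal.ofReal ((sumScale N k * K) ^ (2 * k)) := by
        gcongr with i
        have := h.lintegral_inner_pow_le (ι := ι) hN hk hcard (stdOrthonormalBasis ℝ E i)
        rwa [(stdOrthonormalBasis ℝ E).norm_eq_one, mul_one] at this
    _ = _ := by
        rw [Finset.sum_const, Finset.card_univ, Fintype.card_fin, nsmul_eq_mul,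
          ← ENNReal.ofReal_mul (by positivity), ← ENNReal.ofReal_natCast,
          ← ENNReal.ofReal_mul (by positivity), mul_pow (√(d : ℝ)), pow_mul (√(d : ℝ)),
          Real.sq_sqrt (by positivity)]
        congr 1
        obtain ⟨l, rfl⟩ := Nat.exists_eq_add_of_le' hk
        rw [Nat.add_sub_cancel, pow_succ]; ring

variable [DecidableEq ι]

/-- Moments of a decoupled bilinear form. Given the columns, the sum over the rows is a linear form
in independent centered vectors, so its moments are controlled by the norm of the other sum. -/
theorem SubExpVec.lintegral_decoupled_pow_le (h : SubExpVec μ Z b K) {N k : ℕ} (hN : 1 ≤ N)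
    (hk : 1 ≤ k) (hcard : Fintype.card ι ≤ N) (G : E →L[ℝ] E) (I : Finset ι) :
    ∫⁻ a : ι → α, ENNReal.ofReal ((∑ i ∈ I, ∑ j ∈ Iᶜ,
        inner ℝ (Z (a i) - b) (G (Z (a j) - b))) ^ (2 * k)) ∂(Measure.pi fun _ => μ)
      ≤ ENNReal.ofReal
          ((√(Module.finrank ℝ E) * ‖G‖ * (sumScale N k * K) ^ 2) ^ (2 * k)) := by
  classical
  obtain ⟨p, hp⟩ : ∃ p : ι → Prop, ∀ i, i ∈ I ↔ p i := ⟨fun i => i ∈ I, fun _ => Iff.rfl⟩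
  have hI : Fintype.card {i // p i} ≤ N := (Fintype.card_subtype_le _).trans hcard
  have hI' : Fintype.card {i // ¬ p i} ≤ N := (Fintype.card_subtype_le _).trans hcard
  have hm1 := h.measurable_centeredSum (ι := {i // p i})
  have hm2 := h.measurable_centeredSum (ι := {i // ¬ p i})
  have hG := G.measurable
  have hs0 : 0 ≤ sumScale N k := sumScale_nonneg (by positivity)
  have hK := h.nonneg
  let F : ({i // p i} → α) × ({i // ¬ p i} → α) → ℝ≥0∞ := fun q =>
    ENNReal.ofReal (inner ℝ (G (centeredSum Z b q.2)) (centeredSum Z b q.1) ^ (2 * k))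
  have hF : Measurable F := by fun_prop
  have hmp := measurePreserving_piEquivPiSubtypeProd (fun _ : ι => μ) p
  have e1 : ∀ a : ι → α, ENNReal.ofReal ((∑ i ∈ I, ∑ j ∈ Iᶜ,
      inner ℝ (Z (a i) - b) (G (Z (a j) - b))) ^ (2 * k))
      = F (MeasurableEquiv.piEquivPiSubtypeProd (fun _ => α) p a) := by
    intro a
    have s1 : ∑ i ∈ I, (Z (a i) - b) = ∑ i : {i // p i}, (Z (a i) - b) :=
      Finset.sum_subtype I hp (fun i => Z (a i) - b)
    have s2 : ∑ i ∈ Iᶜ, (Z (a i) - b) = ∑ i : {i // ¬ p i}, (Z (a i) - b) :=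
      Finset.sum_subtype Iᶜ (fun i => by rw [Finset.mem_compl, hp]) (fun i => Z (a i) - b)
    have s3 : ∑ i ∈ I, ∑ j ∈ Iᶜ, inner ℝ (Z (a i) - b) (G (Z (a j) - b))
        = inner ℝ (G (∑ i ∈ Iᶜ, (Z (a i) - b))) (∑ i ∈ I, (Z (a i) - b)) := by
      rw [real_inner_comm, sum_inner]
      simp_rw [map_sum, inner_sum]
    rw [s3, s1, s2]
    rfl
  simp_rw [e1]
  rw [hmp.lintegral_comp hF, lintegral_prod_symm _ hF.aemeasurable]
  calc ∫⁻ y, ∫⁻ x, F (x, y) ∂(Measure.pi fun _ => μ) ∂(Measure.pi fun _ => μ)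
      ≤ ∫⁻ y : {i // ¬ p i} → α, ENNReal.ofReal ((sumScale N k * K * ‖G‖) ^ (2 * k))
          * ENNReal.ofReal (‖centeredSum Z b y‖ ^ (2 * k)) ∂(Measure.pi fun _ => μ) := by
        refine lintegral_mono fun y => ?_
        refine (h.lintegral_inner_pow_le hN hk hI (G (centeredSum Z b y))).trans ?_
        rw [← ENNReal.ofReal_mul (by positivity), ← mul_pow]
        apply ENNReal.ofReal_le_ofReal
        have := G.le_opNorm (centeredSum Z b y)
        calc (sumScale N k * (K * ‖G (centeredSum Z b y)‖)) ^ (2 * k)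
            ≤ (sumScale N k * (K * (‖G‖ * ‖centeredSum Z b y‖))) ^ (2 * k) := by gcongr
          _ = _ := by congr 1; ring
    _ = ENNReal.ofReal ((sumScale N k * K * ‖G‖) ^ (2 * k)) * ∫⁻ y : {i // ¬ p i} → α,
          ENNReal.ofReal (‖centeredSum Z b y‖ ^ (2 * k)) ∂(Measure.pi fun _ => μ) :=
        lintegral_const_mul _ (by fun_prop)
    _ ≤ ENNReal.ofReal ((sumScale N k * K * ‖G‖) ^ (2 * k))
          * ENNReal.ofReal ((√(Module.finrank ℝ E) * (sumScale N k * K)) ^ (2 * k)) := by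
        gcongr
        exact h.lintegral_norm_pow_le hN hk hI'
    _ = _ := by
        rw [← ENNReal.ofReal_mul (by positivity), ← mul_pow]
        congr 2
        ring

/-- Moments of the completely degenerate part of the U-statistic. -/
theorem SubExpVec.lintegral_offDiag_pow_le (h : SubExpVec μ Z b K) {N k : ℕ} (hN : 1 ≤ N)
    (hk : 1 ≤ k) (hcard : Fintype.card ι ≤ N) (G : E →L[ℝ] E) :
    ∫⁻ a : ι → α, ENNReal.ofReal ((∑ i, ∑ j, if i ≠ j then
        inner ℝ (Z (a i) - b) (G (Z (a j) - b)) else 0) ^ (2 * k)) ∂(Measure.pi fun _ => μ)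
      ≤ ENNReal.ofReal
          ((4 * (√(Module.finrank ℝ E) * ‖G‖ * (sumScale N k * K) ^ 2)) ^ (2 * k)) := by
  have hZ := h.measurable
  have hG := G.measurable
  set B := √(Module.finrank ℝ E) * ‖G‖ * (sumScale N k * K) ^ 2
  have hB : 0 ≤ B := by positivity
  set w : ℝ := (2 ^ Fintype.card ι : ℝ)⁻¹ with hw
  have hw0 : 0 ≤ w := by positivity
  let f : Finset ι → (ι → α) → ℝ := fun I a =>
    ∑ i ∈ I, ∑ j ∈ Iᶜ, inner ℝ (Z (a i) - b) (G (Z (a j) - b))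
  have hf : ∀ I, Measurable (f I) := fun I => by fun_prop
  calc _ ≤ ∫⁻ a : ι → α, ∑ I : Finset ι, ENNReal.ofReal (w * 4 ^ (2 * k))
          * ENNReal.ofReal (f I a ^ (2 * k)) ∂(Measure.pi fun _ => μ) := by
        refine lintegral_mono fun a => ?_
        refine (ENNReal.ofReal_le_ofReal (pow_sum_offDiag_le _ k)).trans_eq ?_
        rw [ENNReal.ofReal_sum_of_nonneg
          (fun i _ => mul_nonneg (by positivity) ((even_two_mul k).pow_nonneg _))]
        refine Finset.sum_congr rfl fun I _ => ?_
        rw [mul_pow, ← mul_assoc, ENNReal.ofReal_mul (by positivity)]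
    _ = ∑ I : Finset ι, ENNReal.ofReal (w * 4 ^ (2 * k)) * ∫⁻ a : ι → α,
          ENNReal.ofReal (f I a ^ (2 * k)) ∂(Measure.pi fun _ => μ) := by
        rw [lintegral_finsetSum _ (fun i _ => by fun_prop)]
        exact Finset.sum_congr rfl fun i _ => lintegral_const_mul _ (by fun_prop)
    _ ≤ ∑ _I : Finset ι, ENNReal.ofReal (w * 4 ^ (2 * k)) * ENNReal.ofReal (B ^ (2 * k)) := by
        gcongr with I
        exact h.lintegral_decoupled_pow_le hN hk hcard G I
    _ = _ := by
        rw [Finset.sum_const, Finset.card_univ, Fintype.card_finset, nsmul_eq_mul,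
          ← ENNReal.ofReal_mul (by positivity), ← ENNReal.ofReal_natCast,
          ← ENNReal.ofReal_mul (by positivity), mul_pow 4 B, hw]
        congr 1
        push_cast
        field_simp

end VectorSums

section UStatistic

variable {α E : Type*} [MeasurableSpace α] {μ : Measure α} [IsProbabilityMeasure μ]
  [NormedAddCommGroup E] [InnerProductSpace ℝ E] [FiniteDimensional ℝ E] [MeasurableSpace E]
  [BorelSpace E] {Z : α → E} {b : E} {K : ℝ} {n : ℕ}

/-- The U-statistic with kernel `⟨Z(a), G Z(a')⟩`. -/
noncomputable def uStat (G : E →L[ℝ] E) (Z : α → E) (a : Fin n → α) : ℝ :=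
  ((n.choose 2 : ℕ) : ℝ)⁻¹ * ∑ s, ∑ t ∈ Finset.Ioi s, inner ℝ (Z (a s)) (G (Z (a t)))

theorem sum_sum_Ioi_eq_half {n : ℕ} (f : Fin n → Fin n → ℝ) (hf : ∀ i j, f i j = f j i) :
    ∑ s, ∑ t ∈ Finset.Ioi s, f s t = (∑ i, ∑ j, if i ≠ j then f i j else 0) / 2 := by
  have h1 : ∑ s, ∑ t ∈ Finset.Ioi s, f s t = ∑ i, ∑ j, if i < j then f i j else 0 := by
    refine Finset.sum_congr rfl fun i _ => ?_
    rw [← Finset.sum_filter]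
    congr 1; ext j; simp
  have h2 : ∑ i, ∑ j, (if i < j then f i j else 0) = ∑ i, ∑ j, if j < i then f i j else 0 := by
    rw [Finset.sum_comm]
    refine Finset.sum_congr rfl fun i _ => Finset.sum_congr rfl fun j _ => ?_
    rw [hf]
  have h3 : ∑ i, ∑ j, (if i ≠ j then f i j else 0)
      = (∑ i, ∑ j, if i < j then f i j else 0) + ∑ i, ∑ j, if j < i then f i j else 0 := by
    simp_rw [← Finset.sum_add_distrib]
    refine Finset.sum_congr rfl fun i _ => Finset.sum_congr rfl fun j _ => ?_
    rcases lt_trichotomy i j with h | h | h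
    · simp [h, h.ne, h.not_gt]
    · simp [h]
    · simp [h, h.ne', h.not_gt]
  rw [h1, h3, ← h2]; ring

omit [FiniteDimensional ℝ E] [MeasurableSpace E] [BorelSpace E] [MeasurableSpace α] in
/-- Hoeffding decomposition of the U-statistic around its mean `⟨b, G b⟩`. -/
theorem uStat_sub_eq (hn : 2 ≤ n) {G : E →L[ℝ] E}
    (hG : ∀ x y, inner ℝ x (G y) = inner ℝ y (G x)) (Z : α → E) (b : E) (a : Fin n → α) :
    uStat G Z a - inner ℝ b (G b)
      = 2 / n * inner ℝ (G b) (centeredSum Z b a)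
        + ((n : ℝ) * (n - 1))⁻¹ * ∑ i, ∑ j, if i ≠ j then
            inner ℝ (Z (a i) - b) (G (Z (a j) - b)) else 0 := by
  have hn2 : (2 : ℝ) ≤ n := by exact_mod_cast hn
  have hn0 : (n : ℝ) ≠ 0 := by positivity
  have hn1 : (n : ℝ) - 1 ≠ 0 := by linarith
  have hch : ((n.choose 2 : ℕ) : ℝ) = n * (n - 1) / 2 := Nat.cast_choose_two ℝ n
  set L := inner ℝ (G b) (centeredSum Z b a) with hL
  set q : ℝ := inner ℝ b (G b) with hq
  have hexp : ∀ i j, inner ℝ (Z (a i)) (G (Z (a j)))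
      = inner ℝ (Z (a i) - b) (G (Z (a j) - b)) + inner ℝ (G b) (Z (a i) - b)
        + inner ℝ (G b) (Z (a j) - b) + q := by
    intro i j
    have h1 : inner ℝ b (G (Z (a j))) = inner ℝ (G b) (Z (a j)) := by
      rw [hG, real_inner_comm]
    simp only [map_sub, inner_sub_left, inner_sub_right, hq, h1,
      real_inner_comm (G b) (Z (a i)), real_inner_comm (G b) b]
    ring
  have hconst : ∀ c : Fin n → ℝ, ∑ i, ∑ j, (if i ≠ j then c i else 0) = (n - 1) * ∑ i, c i := by
    intro c
    rw [Finset.mul_sum]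
    refine Finset.sum_congr rfl fun i _ => ?_
    rw [← Finset.sum_filter, Finset.sum_const, Finset.filter_ne, Finset.card_erase_of_mem
      (Finset.mem_univ i), Finset.card_univ, Fintype.card_fin, nsmul_eq_mul,
      Nat.cast_sub (by omega)]
    simp
  have hconst' : ∀ c : Fin n → ℝ, ∑ i, ∑ j, (if i ≠ j then c j else 0) = (n - 1) * ∑ i, c i := by
    intro c
    rw [Finset.sum_comm, ← hconst c]
    refine Finset.sum_congr rfl fun i _ => Finset.sum_congr rfl fun j _ => ?_
    simp only [ne_comm]
  have hLs : ∑ i, inner ℝ (G b) (Z (a i) - b) = L := by rw [hL, centeredSum, inner_sum]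
  have hsplit : ∑ i, ∑ j, (if i ≠ j then inner ℝ (Z (a i)) (G (Z (a j))) else 0)
      = (∑ i, ∑ j, if i ≠ j then inner ℝ (Z (a i) - b) (G (Z (a j) - b)) else 0)
        + 2 * (n - 1) * L + n * (n - 1) * q := by
    have h1 := hconst fun i => inner ℝ (G b) (Z (a i) - b)
    have h2 := hconst' fun i => inner ℝ (G b) (Z (a i) - b)
    have h3 := hconst fun _ => q
    rw [hLs] at h1 h2
    rw [Finset.sum_const, Finset.card_univ, Fintype.card_fin, nsmul_eq_mul] at h3
    have h4 : ∀ i j, (if i ≠ j then inner ℝ (Z (a i)) (G (Z (a j))) else 0)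
        = (if i ≠ j then inner ℝ (Z (a i) - b) (G (Z (a j) - b)) else 0)
          + (if i ≠ j then inner ℝ (G b) (Z (a i) - b) else 0)
          + (if i ≠ j then inner ℝ (G b) (Z (a j) - b) else 0) + (if i ≠ j then q else 0) := by
      intro i j
      split_ifs
      · exact hexp i j
      · simp
    simp_rw [h4, Finset.sum_add_distrib]
    rw [h1, h2, h3]; ring
  rw [uStat, sum_sum_Ioi_eq_half _ fun i j => hG _ _, hsplit, hch]
  field_simp
  ring

/-- Concentration of the U-statistic around its mean. -/
theorem SubExpVec.measure_uStat_gt_le (h : SubExpVec μ Z b K) {k : ℕ} (hn : 2 ≤ n) (hk : 1 ≤ k)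
    {G : E →L[ℝ] E} (hG : ∀ x y, inner ℝ x (G y) = inner ℝ y (G x)) :
    (Measure.pi fun _ : Fin n => μ) {a | 2 / n * (Real.exp 1 * (sumScale n k * (K * ‖G b‖)))
        + 2 / (n : ℝ) ^ 2 * (Real.exp 1 *
            (4 * (√(Module.finrank ℝ E) * ‖G‖ * (sumScale n k * K) ^ 2)))
        < |uStat G Z a - inner ℝ b (G b)|}
      ≤ ENNReal.ofReal (2 * Real.exp (-(2 * k))) := by
  have hn2 : (2 : ℝ) ≤ n := by exact_mod_cast hn
  have hZ := h.measurable
  have hGm := G.measurable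
  have hK := h.nonneg
  have hs0 : 0 ≤ sumScale n k := sumScale_nonneg (by positivity)
  have hm := h.measurable_centeredSum (ι := Fin n)
  have t1 := measure_lt_abs_le_of_lintegral_pow_le (by fun_prop) (by positivity) hk
    (h.lintegral_inner_pow_le (ι := Fin n) (N := n) (by omega) hk (by simp) (G b))
  have t2 := measure_lt_abs_le_of_lintegral_pow_le
    (by
      refine Finset.measurable_sum _ fun i _ => Finset.measurable_sum _ fun j _ => ?_
      split_ifs <;> fun_prop) (by positivity) hk
    (h.lintegral_offDiag_pow_le (ι := Fin n) (N := n) (by omega) hk (by simp) G)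
  rw [two_mul (Real.exp _), ENNReal.ofReal_add (by positivity) (by positivity)]
  refine (measure_mono ?_).trans ((measure_union_le _ _).trans (add_le_add t1 t2))
  intro a ha
  by_contra hcon
  simp only [Set.mem_union, Set.mem_ofPred_eq, not_or, not_lt] at hcon
  obtain ⟨c1, c2⟩ := hcon
  refine absurd (Set.mem_ofPred_eq ▸ ha) (not_lt.2 ?_)
  rw [uStat_sub_eq hn hG]
  have hinv : ((n : ℝ) * (n - 1))⁻¹ ≤ 2 / (n : ℝ) ^ 2 := by
    rw [inv_eq_one_div, div_le_div_iff₀ (by nlinarith) (by positivity)]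
    nlinarith
  have hinv0 : 0 ≤ ((n : ℝ) * (n - 1))⁻¹ := inv_nonneg.2 (by nlinarith)
  refine (abs_add_le _ _).trans ?_
  rw [abs_mul, abs_mul, abs_of_nonneg hinv0, abs_of_nonneg (by positivity : (0 : ℝ) ≤ 2 / n)]
  gcongr

end UStatistic

/-! ### Perturbation of the residual quadratic form and pseudoinverses -/


section Perturbation

variable {E : Type*} [NormedAddCommGroup E] [InnerProductSpace ℝ E]

/-- The operators entering the estimator: `S` is symmetric and bounded below by `c`, `T` is its
inverse, and `Q` is symmetric with `Q S Q = Q` (an inverse of a compression of `S`). -/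
structure CompressedInverse (S T Q : E →L[ℝ] E) (c : ℝ) : Prop where
  pos : 0 < c
  lower : ∀ x, c * ‖x‖ ^ 2 ≤ inner ℝ x (S x)
  symm_left : ∀ x y, inner ℝ x (T y) = inner ℝ y (T x)
  symm_right : ∀ x y, inner ℝ x (Q y) = inner ℝ y (Q x)
  left_inv : ∀ x, T (S x) = x
  right_inv : ∀ x, S (T x) = x
  compress : ∀ x, Q (S (Q x)) = Q x

variable {S T Q A : E →L[ℝ] E} {c : ℝ}

theorem CompressedInverse.symm (h : CompressedInverse S T Q c) (x y : E) :
    inner ℝ x ((T - Q) y) = inner ℝ y ((T - Q) x) := by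
  simp only [_root_.sub_apply, inner_sub_right, h.symm_left x y, h.symm_right x y]

/-- `G = T - Q` satisfies `G S G = G`. -/
theorem CompressedInverse.inner_eq (h : CompressedInverse S T Q c) (x : E) :
    inner ℝ ((T - Q) x) (S ((T - Q) x)) = inner ℝ x ((T - Q) x) := by
  have h1 : (T - Q) (S ((T - Q) x)) = (T - Q) x := by
    simp only [_root_.sub_apply, map_sub, h.left_inv, h.right_inv, h.compress]
    abel
  rw [real_inner_comm, h.symm, h1]

theorem CompressedInverse.norm_sq_le (h : CompressedInverse S T Q c) (x : E) :
    c * ‖(T - Q) x‖ ^ 2 ≤ inner ℝ x ((T - Q) x) :=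
  (h.lower _).trans_eq (h.inner_eq x)

theorem CompressedInverse.opNorm_le (h : CompressedInverse S T Q c) : ‖T - Q‖ ≤ c⁻¹ := by
  have hc := h.pos
  refine ContinuousLinearMap.opNorm_le_bound _ (by positivity) fun x => ?_
  have h1 := (h.norm_sq_le x).trans (real_inner_le_norm _ _)
  rcases (norm_nonneg ((T - Q) x)).eq_or_lt with h0 | h0
  · rw [← h0]; positivity
  · rw [inv_mul_eq_div, le_div_iff₀ hc]
    nlinarith

/-- Perturbation bound for the residual quadratic form. If `g` is the compressed solution of the
equation with operator `A`, the residual `r = b - A g` is annihilated by `Q`, so that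
`G b = T r + G ((A - S) g)`. The first term is compared with the exact value `⟨h, A h⟩`
multiplicatively; only the second one, which involves the single vector `g`, costs an additive
error. -/
theorem CompressedInverse.abs_sub_le (h : CompressedInverse S T Q c) {lam η : ℝ}
    (hc : c = 19 / 20 * lam) (hη : ‖S - A‖ ≤ η) (hηl : η ≤ lam / 20)
    (hA : ∀ x, lam * ‖x‖ ^ 2 ≤ inner ℝ x (A x)) (hS : ∀ x y, inner ℝ x (S y) = inner ℝ y (S x))
    {b β g : E} (hβ : A β = b) (hg : inner ℝ g (A g) = inner ℝ g b) (hQg : Q (S g) = g)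
    (hQr : Q (b - A g) = 0) :
    |inner ℝ b ((T - Q) b) - inner ℝ (β - g) (A (β - g))|
      ≤ inner ℝ (β - g) (A (β - g)) / 8 + 24 * η ^ 2 * ‖b‖ ^ 2 / lam ^ 3 := by
  have hcpos := h.pos
  have hlam : 0 < lam := by linarith
  have hη0 : 0 ≤ η := (norm_nonneg _).trans hη
  set r := b - A g with hr
  set e := (A - S) g with he
  set v := β - g with hv
  set w := T r with hw
  have hAv : A v = r := by rw [hv, map_sub, hβ]
  have hSw : S w = r := h.right_inv r
  have hGr : (T - Q) r = w := by rw [_root_.sub_apply, hQr, sub_zero]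
  have hGSg : (T - Q) (S g) = 0 := by rw [_root_.sub_apply, h.left_inv, hQg, sub_self]
  have hb : b = r + e + S g := by rw [hr, he, _root_.sub_apply]; abel
  set X := inner ℝ v (A v) with hX
  set Y := inner ℝ w (S w) with hY
  have hXl : lam * ‖v‖ ^ 2 ≤ X := hA v
  have hYl : c * ‖w‖ ^ 2 ≤ Y := h.lower w
  have hquad : inner ℝ b ((T - Q) b) = Y + 2 * inner ℝ e w + inner ℝ e ((T - Q) e) := by
    have h1 : (T - Q) b = w + (T - Q) e := by
      rw [hb, map_add, map_add, hGr, hGSg, add_zero]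
    have h2 : inner ℝ (S g) (w + (T - Q) e) = 0 := by
      have : w + (T - Q) e = (T - Q) (r + e) := by rw [map_add, hGr]
      rw [this, h.symm, hGSg, inner_zero_right]
    have h3 : inner ℝ r ((T - Q) e) = inner ℝ e w := by rw [h.symm, hGr]
    have h4 : inner ℝ r w = Y := by rw [hY, hSw, real_inner_comm]
    rw [h1]
    nth_rewrite 1 [hb]
    rw [inner_add_left, h2, inner_add_left, inner_add_right, inner_add_right, h3, h4]
    ring
  have hYX : |Y - X| ≤ η * (‖w‖ * ‖v‖) := by
    have h1 : Y - X = - inner ℝ w ((S - A) v) := by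
      have e1 : Y = inner ℝ w (A v) := by rw [hY, hSw, hAv]
      have e2 : X = inner ℝ w (S v) := by rw [hX, hAv, ← hSw, hS]
      rw [e1, e2, _root_.sub_apply, inner_sub_right]; ring
    rw [h1, abs_neg]
    calc |inner ℝ w ((S - A) v)| ≤ ‖w‖ * ‖(S - A) v‖ := abs_real_inner_le_norm _ _
      _ ≤ ‖w‖ * (η * ‖v‖) := by
          gcongr; exact (ContinuousLinearMap.le_opNorm _ _).trans (by gcongr)
      _ = _ := by ring
  have hYX' : |Y - X| ≤ Y / 38 + X / 40 := by
    refine hYX.trans ?_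
    have h1 : η * (‖w‖ * ‖v‖) ≤ lam / 20 * (‖w‖ * ‖v‖) := by gcongr
    rw [hc] at hYl
    nlinarith [sq_nonneg (‖w‖ - ‖v‖), mul_nonneg hlam.le (sq_nonneg (‖w‖ - ‖v‖))]
  have hX0 : 0 ≤ X := le_trans (by positivity) hXl
  have hY0 : 0 ≤ Y := le_trans (by positivity) hYl
  have hgn : ‖g‖ ≤ ‖b‖ / lam := by
    have h1 := (hA g).trans_eq hg
    have h2 := h1.trans (real_inner_le_norm g b)
    rcases (norm_nonneg g).eq_or_lt with h0 | h0
    · rw [← h0]; positivity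
    · rw [le_div_iff₀ hlam]; nlinarith
  have hen : ‖e‖ ≤ η * (‖b‖ / lam) := by
    calc ‖e‖ ≤ ‖A - S‖ * ‖g‖ := ContinuousLinearMap.le_opNorm _ _
      _ ≤ η * (‖b‖ / lam) := by rw [norm_sub_rev]; gcongr
  have hcross : |2 * inner ℝ e w| ≤ Y / 20 + 20 / c * ‖e‖ ^ 2 := by
    rw [abs_mul, abs_two]
    have h1 := abs_real_inner_le_norm e w
    have h2 : 0 ≤ (c / 20) * (‖w‖ - 20 / c * ‖e‖) ^ 2 := by positivity
    have h3 : (c / 20) * (‖w‖ - 20 / c * ‖e‖) ^ 2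
        = c * ‖w‖ ^ 2 / 20 - 2 * (‖e‖ * ‖w‖) + 20 / c * ‖e‖ ^ 2 := by field_simp; ring
    linarith
  have hlast : |inner ℝ e ((T - Q) e)| ≤ c⁻¹ * ‖e‖ ^ 2 := by
    calc |inner ℝ e ((T - Q) e)| ≤ ‖e‖ * ‖(T - Q) e‖ := abs_real_inner_le_norm _ _
      _ ≤ ‖e‖ * (c⁻¹ * ‖e‖) := by
          gcongr; exact (ContinuousLinearMap.le_opNorm _ _).trans (by gcongr; exact h.opNorm_le)
      _ = _ := by ring
  have hadd : 20 / c * ‖e‖ ^ 2 + c⁻¹ * ‖e‖ ^ 2 ≤ 24 * η ^ 2 * ‖b‖ ^ 2 / lam ^ 3 := by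
    have h1 : ‖e‖ ^ 2 ≤ (η * (‖b‖ / lam)) ^ 2 := by gcongr
    have h2 : 20 / c * ‖e‖ ^ 2 + c⁻¹ * ‖e‖ ^ 2 = (21 * 20 / 19) / lam * ‖e‖ ^ 2 := by
      rw [hc]; field_simp; ring
    rw [h2]
    calc (21 * 20 / 19) / lam * ‖e‖ ^ 2 ≤ 24 / lam * (η * (‖b‖ / lam)) ^ 2 := by
          gcongr; norm_num
      _ = _ := by field_simp
  rw [hquad, abs_le]
  rw [abs_le] at hYX' hcross hlast
  constructor <;> linarith [hYX'.1, hYX'.2, hcross.1, hcross.2, hlast.1, hlast.2]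

end Perturbation

section Pseudoinverse

variable {ι : Type*} [Fintype ι] [DecidableEq ι]

/-- Uniqueness of the Moore-Penrose pseudoinverse. -/
theorem eq_pinv_of_penrose {A X : Matrix ι ι ℝ} (hA : A.IsHermitian) (h1 : A * X * A = A)
    (h2 : X * A * X = X) (h3 : (A * X).IsHermitian) (h4 : (X * A).IsHermitian) :
    pinv A = X := by
  obtain ⟨p1, p2, p3, p4⟩ := pinv_penrose A hA
  set Y := pinv A
  have e1 : A * Y = A * X := by
    have : (A * X) * (A * Y) = A * Y := by rw [← mul_assoc, h1]
    have h5 := congrArg Matrix.conjTranspose this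
    rw [Matrix.conjTranspose_mul, h3.eq, p3.eq, ← mul_assoc, p1] at h5
    exact h5.symm
  have e2 : Y * A = X * A := by
    have : (Y * A) * (X * A) = Y * A := by rw [mul_assoc, ← mul_assoc A, h1]
    have h5 := congrArg Matrix.conjTranspose this
    rw [Matrix.conjTranspose_mul, h4.eq, p4.eq, mul_assoc, ← mul_assoc A, p1] at h5
    exact h5.symm
  rw [← p2, e2, mul_assoc, e1, ← mul_assoc, h2]

theorem pinv_eq_inv {A : Matrix ι ι ℝ} (hA : A.PosDef) : pinv A = A⁻¹ := by
  have hu : IsUnit A.det := (Matrix.isUnit_iff_isUnit_det A).1 hA.isUnit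
  refine eq_pinv_of_penrose hA.isHermitian ?_ ?_ ?_ ?_ <;>
    simp [Matrix.mul_nonsing_inv _ hu, Matrix.nonsing_inv_mul _ hu]

variable {κ : Type*} [Fintype κ] [DecidableEq κ]

theorem pinv_fromBlocks {A : Matrix ι ι ℝ} (hA : A.PosDef) :
    pinv (Matrix.fromBlocks A 0 0 (0 : Matrix κ κ ℝ)) = Matrix.fromBlocks A⁻¹ 0 0 0 := by
  have hu : IsUnit A.det := (Matrix.isUnit_iff_isUnit_det A).1 hA.isUnit
  have hherm : ∀ B : Matrix ι ι ℝ, B.IsHermitian →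
      (Matrix.fromBlocks B 0 0 (0 : Matrix κ κ ℝ)).IsHermitian := fun B hB =>
    Matrix.isHermitian_fromBlocks_iff.2 ⟨hB, by simp, by simp, Matrix.isHermitian_zero⟩
  refine eq_pinv_of_penrose (hherm A hA.isHermitian) ?_ ?_ ?_ ?_
  · simp [Matrix.fromBlocks_multiply, Matrix.mul_nonsing_inv _ hu]
  · simp [Matrix.fromBlocks_multiply, Matrix.nonsing_inv_mul _ hu]
  · simpa [Matrix.fromBlocks_multiply, Matrix.mul_nonsing_inv _ hu]
      using hherm 1 Matrix.isHermitian_one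
  · simpa [Matrix.fromBlocks_multiply, Matrix.nonsing_inv_mul _ hu]
      using hherm 1 Matrix.isHermitian_one

/-- The inverse of the upper left block, padded by zeros. -/
noncomputable def blockInv (S : Matrix (ι ⊕ κ) (ι ⊕ κ) ℝ) : Matrix (ι ⊕ κ) (ι ⊕ κ) ℝ :=
  Matrix.fromBlocks S.toBlocks₁₁⁻¹ 0 0 0

omit [Fintype ι] [DecidableEq ι] [Fintype κ] [DecidableEq κ] in
theorem posDef_toBlocks₁₁ {S : Matrix (ι ⊕ κ) (ι ⊕ κ) ℝ} (hS : S.PosDef) :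
    S.toBlocks₁₁.PosDef :=
  hS.submatrix Sum.inl_injective

theorem blockInv_mul_mul {S : Matrix (ι ⊕ κ) (ι ⊕ κ) ℝ} (hS : S.PosDef) :
    blockInv S * S * blockInv S = blockInv S := by
  have hu : IsUnit S.toBlocks₁₁.det :=
    (Matrix.isUnit_iff_isUnit_det _).1 (posDef_toBlocks₁₁ hS).isUnit
  have : blockInv S * Matrix.fromBlocks S.toBlocks₁₁ S.toBlocks₁₂ S.toBlocks₂₁ S.toBlocks₂₂
      * blockInv S = blockInv S := by
    simp [blockInv, Matrix.fromBlocks_multiply, Matrix.nonsing_inv_mul _ hu]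
  rwa [Matrix.fromBlocks_toBlocks] at this

omit [Fintype κ] [DecidableEq κ] in
theorem blockInv_isHermitian {S : Matrix (ι ⊕ κ) (ι ⊕ κ) ℝ} (hS : S.PosDef) :
    (blockInv S).IsHermitian := by
  rw [blockInv, Matrix.isHermitian_fromBlocks_iff]
  exact ⟨(posDef_toBlocks₁₁ hS).isHermitian.inv, by simp, by simp, Matrix.isHermitian_zero⟩

omit [DecidableEq κ] in
theorem blockInv_mulVec_mulVec {S : Matrix (ι ⊕ κ) (ι ⊕ κ) ℝ} (hS : S.PosDef) {v : ι ⊕ κ → ℝ}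
    (hv : ∀ j, v (Sum.inr j) = 0) : blockInv S *ᵥ (S *ᵥ v) = v := by
  have hu : IsUnit S.toBlocks₁₁.det :=
    (Matrix.isUnit_iff_isUnit_det _).1 (posDef_toBlocks₁₁ hS).isUnit
  have h0 : v = Sum.elim (v ∘ Sum.inl) 0 := by
    ext i; rcases i with i | j
    · rfl
    · simp [hv]
  have : blockInv S *ᵥ (Matrix.fromBlocks S.toBlocks₁₁ S.toBlocks₁₂ S.toBlocks₂₁ S.toBlocks₂₂
      *ᵥ Sum.elim (v ∘ Sum.inl) 0) = Sum.elim (v ∘ Sum.inl) 0 := by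
    simp [blockInv, Matrix.fromBlocks_mulVec, Matrix.nonsing_inv_mul _ hu, Matrix.mulVec_mulVec]
  rwa [Matrix.fromBlocks_toBlocks, ← h0] at this

omit [DecidableEq κ] in
theorem blockInv_mulVec_eq_zero (S : Matrix (ι ⊕ κ) (ι ⊕ κ) ℝ) {v : ι ⊕ κ → ℝ}
    (hv : ∀ i, v (Sum.inl i) = 0) : blockInv S *ᵥ v = 0 := by
  have h0 : v ∘ Sum.inl = 0 := funext hv
  rw [blockInv, Matrix.fromBlocks_mulVec, h0]
  ext i; rcases i with i | j <;> simp

theorem inner_matOp_symm {A : Matrix ι ι ℝ} (hA : A.IsHermitian) (x y : EuclideanSpace ℝ ι) :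
    inner ℝ x (matOp A y) = inner ℝ y (matOp A x) := by
  rw [Matrix.inner_toEuclideanCLM, Matrix.inner_toEuclideanCLM, Matrix.dotProduct_mulVec,
    dotProduct_comm, ← Matrix.mulVec_transpose]
  have : Aᵀ = A := by
    simpa [Matrix.IsHermitian, Matrix.conjTranspose_eq_transpose_of_trivial] using hA
  rw [this]

theorem compressedInverse_matOp {S : Matrix (ι ⊕ κ) (ι ⊕ κ) ℝ} (hS : S.PosDef) {c : ℝ}
    (hc : 0 < c) (hlow : ∀ x, c * ‖x‖ ^ 2 ≤ inner ℝ x (matOp S x)) :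
    CompressedInverse (matOp S) (matOp S⁻¹) (matOp (blockInv S)) c := by
  have hu : IsUnit S.det := (Matrix.isUnit_iff_isUnit_det _).1 hS.isUnit
  refine ⟨hc, hlow, inner_matOp_symm hS.isHermitian.inv,
    inner_matOp_symm (blockInv_isHermitian hS), fun x => ?_, fun x => ?_, fun x => ?_⟩
  · rw [← mul_apply_eq_comp, ← map_mul, Matrix.nonsing_inv_mul _ hu, map_one]; rfl
  · rw [← mul_apply_eq_comp, ← map_mul, Matrix.mul_nonsing_inv _ hu, map_one]; rfl
  · rw [← mul_apply_eq_comp, ← mul_apply_eq_comp, ← map_mul, ← map_mul,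
      blockInv_mul_mul hS]

variable {d₁ d₂ n : ℕ}

theorem toBlocks₁₁_empSecondMoment {m : ℕ}
    (u : Fin m → EuclideanSpace ℝ (Fin d₁ ⊕ Fin d₂)) :
    (empSecondMoment u).toBlocks₁₁ = empSecondMoment fun t => head (u t) := by
  ext i j
  simp [empSecondMoment, Matrix.toBlocks₁₁, head, Matrix.sum_apply, Matrix.vecMulVec_apply]

/-- For positive definite `S` the estimator is the U-statistic of the vectors `y x` with kernel
`G = S⁻¹ - blockInv S`, because `R S R = G`. -/
theorem estimateResidual_eq_uStat
    {S : Matrix (Fin d₁ ⊕ Fin d₂) (Fin d₁ ⊕ Fin d₂) ℝ} (hS : S.PosDef)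
    (z : Fin n → EuclideanSpace ℝ (Fin d₁ ⊕ Fin d₂) × ℝ) :
    estimateResidual S S.toBlocks₁₁ z
      = uStat (matOp S⁻¹ - matOp (blockInv S)) (fun p => p.2 • p.1) z := by
  have hu : IsUnit S.det := (Matrix.isUnit_iff_isUnit_det _).1 hS.isUnit
  have hR : Rhat S S.toBlocks₁₁ = blockInv S - S⁻¹ := by
    rw [Rhat, pinv_eq_inv hS, pinv_fromBlocks (posDef_toBlocks₁₁ hS), blockInv]
  obtain ⟨q1, q2⟩ := matSqrt_spec S hS.posSemidef
  have hRT : (Rhat S S.toBlocks₁₁)ᵀ = Rhat S S.toBlocks₁₁ := by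
    have : (Rhat S S.toBlocks₁₁).IsHermitian := by
      rw [hR]; exact (blockInv_isHermitian hS).sub hS.isHermitian.inv
    simpa [Matrix.IsHermitian, Matrix.conjTranspose_eq_transpose_of_trivial] using this
  have hQT : (matSqrt S)ᵀ = matSqrt S := by
    simpa [Matrix.IsHermitian, Matrix.conjTranspose_eq_transpose_of_trivial]
      using q1.isHermitian
  have hB : (matSqrt S * Rhat S S.toBlocks₁₁)ᵀ * (matSqrt S * Rhat S S.toBlocks₁₁)
      = S⁻¹ - blockInv S := by
    rw [Matrix.transpose_mul, hRT, hQT, mul_assoc, ← mul_assoc (matSqrt S), q2, hR]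
    have h1 : S * S⁻¹ = 1 := Matrix.mul_nonsing_inv _ hu
    have h2 : S⁻¹ * S = 1 := Matrix.nonsing_inv_mul _ hu
    have h3 := blockInv_mul_mul hS
    simp only [mul_sub, sub_mul, ← mul_assoc, h2, h3]
    simp only [mul_assoc, h1, one_mul, mul_one]
    abel
  have hpt : ∀ x y : EuclideanSpace ℝ (Fin d₁ ⊕ Fin d₂),
      ((matSqrt S * Rhat S S.toBlocks₁₁) *ᵥ x.ofLp) ⬝ᵥ
        ((matSqrt S * Rhat S S.toBlocks₁₁) *ᵥ y.ofLp)
      = inner ℝ x ((matOp S⁻¹ - matOp (blockInv S)) y) := by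
    intro x y
    rw [← map_sub, Matrix.inner_toEuclideanCLM, ← hB, Matrix.dotProduct_mulVec x.ofLp,
      ← Matrix.vecMul_vecMul, Matrix.vecMul_transpose, Matrix.dotProduct_mulVec]
  rw [estimateResidual, uStat]
  congr 1
  refine Finset.sum_congr rfl fun s _ => Finset.sum_congr rfl fun t _ => ?_
  exact hpt ((z s).2 • (z s).1) ((z t).2 • (z t).1)

end Pseudoinverse

/-! ### Smallest eigenvalue, normal equations and measurability -/


section LambdaMin

variable {ι : Type*} [Fintype ι] [DecidableEq ι]

theorem lambdaMin_pos [Nonempty ι] {A : Matrix ι ι ℝ} (hA : A.PosDef) : 0 < lambdaMin A := by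
  have hs := hA.isHermitian.spectrum_real_eq_range_eigenvalues
  have hfin : (spectrum ℝ A).Finite := Matrix.finite_real_spectrum
  have hne : (spectrum ℝ A).Nonempty := by rw [hs]; exact Set.range_nonempty _
  have hmem := hne.csInf_mem hfin
  rw [lambdaMin]
  rw [hs] at hmem ⊢
  obtain ⟨i, hi⟩ := hmem
  rw [← hi]
  exact hA.eigenvalues_pos i

theorem lambdaMin_mul_norm_sq_le {A : Matrix ι ι ℝ} (hA : A.IsHermitian)
    (x : EuclideanSpace ℝ ι) : lambdaMin A * ‖x‖ ^ 2 ≤ inner ℝ x (matOp A x) := by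
  have hherm : (A - algebraMap ℝ _ (lambdaMin A)).IsHermitian := by
    refine hA.sub ?_
    rw [Algebra.algebraMap_eq_smul_one]
    simp [Matrix.IsHermitian]
  have hpsd : (A - algebraMap ℝ _ (lambdaMin A)).PosSemidef := by
    rw [hherm.posSemidef_iff_eigenvalues_nonneg]
    intro i
    have hmem : hherm.eigenvalues i ∈ spectrum ℝ (A - algebraMap ℝ _ (lambdaMin A)) := by
      rw [hherm.spectrum_real_eq_range_eigenvalues]; exact ⟨i, rfl⟩
    rw [← spectrum.sub_singleton_eq] at hmem
    obtain ⟨y, hy, z, hz, hyz⟩ := Set.mem_sub.1 hmem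
    rw [Set.mem_singleton_iff] at hz
    have hle : lambdaMin A ≤ y := csInf_le (Matrix.finite_real_spectrum.bddBelow) hy
    show (0 : ℝ) ≤ hherm.eigenvalues i
    rw [← hyz, hz]; linarith
  have h1 := hpsd.dotProduct_mulVec_nonneg x.ofLp
  rw [star_trivial, Matrix.sub_mulVec, dotProduct_sub, Algebra.algebraMap_eq_smul_one,
    Matrix.smul_mulVec, Matrix.one_mulVec, dotProduct_smul, smul_eq_mul] at h1
  rw [Matrix.inner_toEuclideanCLM, ← real_inner_self_eq_norm_sq,
    EuclideanSpace.inner_eq_star_dotProduct, star_trivial]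
  linarith

theorem posDef_of_lower {S : Matrix ι ι ℝ} (hS : S.IsHermitian) {c : ℝ} (hc : 0 < c)
    (hlow : ∀ x, c * ‖x‖ ^ 2 ≤ inner ℝ x (matOp S x)) : S.PosDef := by
  refine Matrix.PosDef.of_dotProduct_mulVec_pos hS fun x hx => ?_
  have h1 := hlow (WithLp.toLp 2 x)
  rw [Matrix.inner_toEuclideanCLM] at h1
  have h2 : WithLp.toLp 2 x ≠ 0 := by simpa using hx
  have h3 : 0 < c * ‖WithLp.toLp 2 x‖ ^ 2 := by positivity
  simpa using h3.trans_le h1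

omit [Fintype ι] [DecidableEq ι] in
theorem empSecondMoment_isHermitian {m : ℕ} (u : Fin m → EuclideanSpace ℝ ι) :
    (empSecondMoment u).IsHermitian := by
  ext i j
  simp only [empSecondMoment, Matrix.conjTranspose_apply, Matrix.smul_apply, Matrix.sum_apply,
    Matrix.vecMulVec_apply, star_trivial, mul_comm]

omit [Fintype ι] [DecidableEq ι] in
theorem secondMoment_isHermitian {Ω : Type*} [MeasurableSpace Ω] (P : Measure Ω)
    (x : Ω → EuclideanSpace ℝ ι) : (secondMoment P x).IsHermitian := by
  ext i j
  simp only [secondMoment, Matrix.conjTranspose_apply, Matrix.of_apply, star_trivial, mul_comm]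

/-- `λ_min(Σ) ≤ 2 τ²`: the sub-Gaussian scale cannot be small compared with the covariance. -/
theorem lambdaMin_le [Nonempty ι] {Ω : Type*} [MeasurableSpace Ω] {P : Measure Ω}
    [IsProbabilityMeasure P] {x : Ω → EuclideanSpace ℝ ι} {τ : ℝ} (h : IsSubGVec P x τ)
    (hx : Measurable x) (hτ : 0 ≤ τ) : lambdaMin (secondMoment P x) ≤ 2 * τ ^ 2 := by
  obtain ⟨i⟩ := ‹Nonempty ι›
  have h1 := lambdaMin_mul_norm_sq_le (secondMoment_isHermitian P x) (EuclideanSpace.single i 1)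
  have hn : ‖EuclideanSpace.single i (1 : ℝ)‖ = 1 := by simp
  rw [inner_matOp_secondMoment (h.integrable_coord_mul hx hτ), hn, one_pow, mul_one] at h1
  have h2 := (h.inner_mul_inner hx hτ (EuclideanSpace.single i 1)
    (EuclideanSpace.single i 1)).integral_abs_pow_le (by positivity) (by fun_prop) le_rfl
  simp only [pow_one, hn, Nat.cast_one] at h2
  have h3 := (le_abs_self _).trans (abs_integral_le_integral_abs.trans h2)
  linarith

end LambdaMin

section NormalEquations

variable {Ω ι : Type*} [MeasurableSpace Ω] [Fintype ι] {P : Measure Ω}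

/-- The best linear predictor satisfies the normal equations. -/
theorem IsBestLinear.normal_eq {x : Ω → EuclideanSpace ℝ ι} {y : Ω → ℝ}
    {β : EuclideanSpace ℝ ι} (h : IsBestLinear P x y β)
    (hx : ∀ v, MemLp (fun ω => inner ℝ v (x ω)) 2 P) (hy : MemLp y 2 P)
    (v : EuclideanSpace ℝ ι) :
    ∫ ω, inner ℝ v (x ω) * inner ℝ β (x ω) ∂P = ∫ ω, inner ℝ v (x ω) * y ω ∂P := by
  have hr : MemLp (fun ω => inner ℝ β (x ω) - y ω) 2 P := (hx β).sub hy
  have i1 : Integrable (fun ω => inner ℝ v (x ω) * (inner ℝ β (x ω) - y ω)) P :=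
    (hx v).integrable_mul hr
  have i2 : Integrable (fun ω => inner ℝ v (x ω) ^ 2) P := (hx v).integrable_sq
  have i3 : Integrable (fun ω => (inner ℝ β (x ω) - y ω) ^ 2) P := hr.integrable_sq
  set c := ∫ ω, inner ℝ v (x ω) * (inner ℝ β (x ω) - y ω) ∂P with hc
  set q := ∫ ω, inner ℝ v (x ω) ^ 2 ∂P with hq
  have hexp : ∀ t : ℝ, sqLoss P x y (β + t • v) = sqLoss P x y β + 2 * t * c + t ^ 2 * q := by
    intro t
    have e1 : ∀ ω, (inner ℝ (β + t • v) (x ω) - y ω) ^ 2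
        = (inner ℝ β (x ω) - y ω) ^ 2
          + 2 * t * (inner ℝ v (x ω) * (inner ℝ β (x ω) - y ω))
          + t ^ 2 * inner ℝ v (x ω) ^ 2 := by
      intro ω
      rw [inner_add_left, real_inner_smul_left]; ring
    simp only [sqLoss, e1]
    have i4 : Integrable (fun ω => (inner ℝ β (x ω) - y ω) ^ 2
          + 2 * t * (inner ℝ v (x ω) * (inner ℝ β (x ω) - y ω))) P := i3.add (i1.const_mul _)
    rw [integral_add i4 (i2.const_mul _), integral_add i3 (i1.const_mul _), integral_const_mul,
      integral_const_mul]
  have hq0 : 0 ≤ q := integral_nonneg fun ω => sq_nonneg _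
  have hmin : ∀ t : ℝ, 0 ≤ 2 * t * c + t ^ 2 * q := by
    intro t
    have := h (Set.mem_univ (β + t • v))
    simp only [Set.mem_ofPred_eq, hexp] at this
    linarith
  have hc0 : c = 0 := by
    have h1 := hmin (-c / (q + 1))
    have h2 : 2 * (-c / (q + 1)) * c + (-c / (q + 1)) ^ 2 * q
        = -(c ^ 2 * (q + 2) / (q + 1) ^ 2) := by field_simp; ring
    rw [h2] at h1
    have h3 : 0 ≤ c ^ 2 * (q + 2) / (q + 1) ^ 2 := by positivity
    have h4 : c ^ 2 * (q + 2) / (q + 1) ^ 2 = 0 := by linarith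
    rw [div_eq_zero_iff] at h4
    rcases h4 with h4 | h4
    · rcases mul_eq_zero.1 h4 with h5 | h5
      · simpa using h5
      · linarith
    · have : 0 < (q + 1) ^ 2 := by positivity
      linarith
  have hsub : c = ∫ ω, inner ℝ v (x ω) * inner ℝ β (x ω) ∂P - ∫ ω, inner ℝ v (x ω) * y ω ∂P := by
    have j1 : Integrable (fun ω => inner ℝ v (x ω) * inner ℝ β (x ω)) P :=
      (hx v).integrable_mul (hx β)
    have j2 : Integrable (fun ω => inner ℝ v (x ω) * y ω) P := (hx v).integrable_mul hy
    rw [hc, ← integral_sub j1 j2]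
    simp only [mul_sub]
  linarith

/-- The vector `x y` has sub-exponential marginals. -/
theorem subExpVec_smul [IsProbabilityMeasure P] {x : Ω → EuclideanSpace ℝ ι} {y : Ω → ℝ}
    {τ σ : ℝ} (hτ : 0 ≤ τ) (hσ : 0 ≤ σ) (hx : IsSubGVec P x τ) (hy : IsSubG P y σ)
    (hxm : Measurable x) (hym : Measurable y) :
    SubExpVec P (fun ω => y ω • x ω) (∫ ω, y ω • x ω ∂P) (2 * τ * σ) := by
  have hmom : ∀ θ : EuclideanSpace ℝ ι, SubExpMoments P (fun ω => inner ℝ θ (y ω • x ω))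
      (2 * τ * σ * ‖θ‖) := by
    intro θ
    have h1 := (hx.isSubG_inner θ).mul hy (by positivity) hσ (by fun_prop) hym
    have h2 : 2 * (‖θ‖ * τ) * σ = 2 * τ * σ * ‖θ‖ := by ring
    rw [h2] at h1
    simpa only [real_inner_smul_right, mul_comm] using h1
  have hint : Integrable (fun ω => y ω • x ω) P := by
    have h1 : (fun ω => y ω • x ω) = fun ω => ∑ i,
        inner ℝ (EuclideanSpace.basisFun ι ℝ i) (y ω • x ω) • EuclideanSpace.basisFun ι ℝ i := by
      funext ω
      exact ((EuclideanSpace.basisFun ι ℝ).sum_repr' (y ω • x ω)).symm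
    rw [h1]
    exact integrable_finsetSum _ fun i _ =>
      ((hmom _).integrable (by fun_prop)).smul_const _
  exact ⟨by fun_prop, by positivity, hmom, fun θ => integral_inner hint θ⟩

end NormalEquations

section Measurability

variable {ι κ Ω : Type*} [Fintype ι] [DecidableEq ι] [Fintype κ] [DecidableEq κ]
  [MeasurableSpace Ω]

theorem measurable_inv_entry {M : Ω → Matrix ι ι ℝ} (hM : ∀ i j, Measurable fun ω => M ω i j)
    (i j : ι) : Measurable fun ω => (M ω)⁻¹ i j := by
  have hMm : Measurable fun ω => (fun i j => M ω i j : ι → ι → ℝ) :=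
    measurable_pi_lambda _ fun i => measurable_pi_lambda _ fun j => hM i j
  have c1 : Continuous fun A : ι → ι → ℝ => (Matrix.of A).det :=
    Continuous.matrix_det continuous_id
  have c2 : Continuous fun A : ι → ι → ℝ => (Matrix.of A).adjugate i j :=
    (Continuous.matrix_adjugate continuous_id).matrix_elem i j
  have h1 : Measurable fun ω => (M ω).det := c1.measurable.comp hMm
  have h2 : Measurable fun ω => (M ω).adjugate i j := c2.measurable.comp hMm
  simp only [Matrix.inv_def, Matrix.smul_apply, smul_eq_mul, Ring.inverse_eq_inv']
  exact h1.inv.mul h2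

theorem measurable_norm_matOp {M : Ω → Matrix ι ι ℝ} (hM : ∀ i j, Measurable fun ω => M ω i j) :
    Measurable fun ω => ‖matOp (M ω)‖ := by
  have hMm : Measurable fun ω => (fun i j => M ω i j : ι → ι → ℝ) :=
    measurable_pi_lambda _ fun i => measurable_pi_lambda _ fun j => hM i j
  have hcont : Continuous fun A : Matrix ι ι ℝ => matOp A :=
    LinearMap.continuous_of_finiteDimensional
      (Matrix.toEuclideanCLM (n := ι) (𝕜 := ℝ)).toAlgEquiv.toLinearEquiv.toLinearMap
  have c1 : Continuous fun A : ι → ι → ℝ => ‖matOp (Matrix.of A)‖ := hcont.norm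
  exact c1.measurable.comp hMm

theorem measurable_inner_matOp {M : Ω → Matrix ι ι ℝ} (hM : ∀ i j, Measurable fun ω => M ω i j)
    {x y : Ω → EuclideanSpace ℝ ι} (hx : Measurable x) (hy : Measurable y) :
    Measurable fun ω => inner ℝ (x ω) (matOp (M ω) (y ω)) := by
  simp only [Matrix.inner_toEuclideanCLM, dotProduct, Matrix.mulVec]
  fun_prop

theorem measurable_sub_blockInv_entry {M : Ω → Matrix (ι ⊕ κ) (ι ⊕ κ) ℝ}
    (hM : ∀ i j, Measurable fun ω => M ω i j) (i j : ι ⊕ κ) :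
    Measurable fun ω => ((M ω)⁻¹ - blockInv (M ω)) i j := by
  simp only [Matrix.sub_apply]
  refine (measurable_inv_entry hM i j).sub ?_
  rcases i with i | i <;> rcases j with j | j <;> simp only [blockInv, Matrix.fromBlocks_apply₁₁,
    Matrix.fromBlocks_apply₁₂, Matrix.fromBlocks_apply₂₁, Matrix.fromBlocks_apply₂₂]
  · exact measurable_inv_entry (fun i j => hM (Sum.inl i) (Sum.inl j)) i j
  all_goals exact measurable_const

omit [Fintype ι] [DecidableEq ι] in
theorem measurable_empSecondMoment_entry {m : ℕ} (i j : ι) :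
    Measurable fun u : Fin m → EuclideanSpace ℝ ι => empSecondMoment u i j := by
  simp only [empSecondMoment, Matrix.smul_apply, Matrix.sum_apply, Matrix.vecMulVec_apply]
  fun_prop

end Measurability

/-! ### Bias of the estimator, numerical bounds and exceptional sets -/


section Population

variable {d₁ d₂ : ℕ}

/-- A vector of the first `d₁` coordinates, padded by zeros. -/
def padZero (v : EuclideanSpace ℝ (Fin d₁)) : EuclideanSpace ℝ (Fin d₁ ⊕ Fin d₂) :=
  WithLp.toLp 2 (Sum.elim v.ofLp 0)

theorem inner_padZero (v : EuclideanSpace ℝ (Fin d₁))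
    (x : EuclideanSpace ℝ (Fin d₁ ⊕ Fin d₂)) :
    inner ℝ (padZero v) x = inner ℝ v (head x) := by
  simp [padZero, head, PiLp.inner_apply]

theorem inner_padZero_single (i : Fin d₁) (x : EuclideanSpace ℝ (Fin d₁ ⊕ Fin d₂)) :
    inner ℝ (padZero (EuclideanSpace.single i 1)) x = x (Sum.inl i) := by
  rw [inner_padZero, EuclideanSpace.inner_single_left]
  simp [head]

variable {P : Measure (EuclideanSpace ℝ (Fin d₁ ⊕ Fin d₂) × ℝ)} [IsProbabilityMeasure P] {τ σ : ℝ}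

/-- For every empirical second moment matrix close to the population one, the mean `⟨b, G b⟩` of
the estimator is close to the square loss gap. -/
theorem abs_mean_sub_sqGap_le (hτ : 0 ≤ τ) (hσ : 0 ≤ σ)
    (hx : IsSubGVec P (fun p => p.1) τ) (hy : IsSubG P (fun p => p.2) σ)
    {β : EuclideanSpace ℝ (Fin d₁ ⊕ Fin d₂)} {β₁ : EuclideanSpace ℝ (Fin d₁)}
    (hβ : IsBestLinear P (fun p => p.1) (fun p => p.2) β)
    (hβ₁ : IsBestLinear P (fun p => head p.1) (fun p => p.2) β₁)
    {S : Matrix (Fin d₁ ⊕ Fin d₂) (Fin d₁ ⊕ Fin d₂) ℝ} (hS : S.PosDef) {lam η c : ℝ}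
    (hC : CompressedInverse (matOp S) (matOp S⁻¹) (matOp (blockInv S)) c)
    (hc : c = 19 / 20 * lam) (hη : ‖matOp S - matOp (secondMoment P fun p => p.1)‖ ≤ η)
    (hηl : η ≤ lam / 20)
    (hA : ∀ x, lam * ‖x‖ ^ 2 ≤ inner ℝ x (matOp (secondMoment P fun p => p.1) x)) :
    |inner ℝ (∫ p, p.2 • p.1 ∂P) ((matOp S⁻¹ - matOp (blockInv S)) (∫ p, p.2 • p.1 ∂P))
        - sqGap P β β₁|
      ≤ sqGap P β β₁ / 8 + 24 * η ^ 2 * ‖∫ p, p.2 • p.1 ∂P‖ ^ 2 / lam ^ 3 := by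
  set b := ∫ p, p.2 • p.1 ∂P
  set A := matOp (secondMoment P fun p => p.1) with hAdef
  have hxL2 : ∀ v : EuclideanSpace ℝ (Fin d₁ ⊕ Fin d₂),
      MemLp (fun p : EuclideanSpace ℝ (Fin d₁ ⊕ Fin d₂) × ℝ => inner ℝ v p.1) 2 P := fun v =>
    (hx.isSubG_inner v).memLp (by fun_prop)
  have hyL2 := hy.memLp measurable_snd
  have hcoord := hx.integrable_coord_mul measurable_fst hτ
  have hmean : ∀ v : EuclideanSpace ℝ (Fin d₁ ⊕ Fin d₂),
      ∫ p : EuclideanSpace ℝ (Fin d₁ ⊕ Fin d₂) × ℝ, inner ℝ v p.1 * p.2 ∂P = inner ℝ v b := by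
    intro v
    have := (subExpVec_smul hτ hσ hx hy measurable_fst measurable_snd).mean v
    simpa only [real_inner_smul_right, mul_comm] using this
  have hAβ : A β = b := by
    refine ext_inner_left ℝ fun v => ?_
    rw [hAdef, inner_matOp_secondMoment hcoord, ← hmean v, ← hβ.normal_eq hxL2 hyL2 v]
  have hAg : ∀ v : EuclideanSpace ℝ (Fin d₁),
      inner ℝ (padZero v) (A (padZero β₁)) = inner ℝ (padZero v) b := by
    intro v
    have hxL2' : ∀ v : EuclideanSpace ℝ (Fin d₁),
        MemLp (fun p : EuclideanSpace ℝ (Fin d₁ ⊕ Fin d₂) × ℝ => inner ℝ v (head p.1)) 2 P := by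
      intro v
      simpa only [inner_padZero] using hxL2 (padZero v)
    rw [hAdef, inner_matOp_secondMoment hcoord, ← hmean (padZero v)]
    simp only [inner_padZero]
    exact hβ₁.normal_eq hxL2' hyL2 v
  have hgap : sqGap P β β₁ = inner ℝ (β - padZero β₁) (A (β - padZero β₁)) := by
    rw [hAdef, inner_matOp_secondMoment hcoord, sqGap]
    refine integral_congr_ae (ae_of_all _ fun p => ?_)
    simp only [inner_sub_left, inner_padZero]
    ring
  rw [hgap]
  refine hC.abs_sub_le hc hη hηl hA (inner_matOp_symm hS.isHermitian) hAβ (hAg β₁) ?_ ?_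
  · apply WithLp.ofLp_injective
    exact blockInv_mulVec_mulVec hS fun j => rfl
  · apply WithLp.ofLp_injective
    refine blockInv_mulVec_eq_zero S fun i => ?_
    have h1 : inner ℝ (padZero (EuclideanSpace.single i 1)) (b - A (padZero β₁)) = 0 := by
      rw [inner_sub_right, hAg, sub_self]
    rwa [inner_padZero_single] at h1

end Population

section Numerics

theorem sumScale_sq_le {N k : ℝ} (hN : 0 ≤ N) (hk : 0 ≤ k) :
    sumScale N k ^ 2 ≤ 968 * (N * k + k ^ 2) := by
  have h1 := Real.sq_sqrt (mul_nonneg hN hk)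
  rw [sumScale]
  nlinarith [sq_nonneg (√(N * k) - k)]

theorem exp_one_sq_le : Real.exp 1 ^ 2 ≤ 7.39 := by
  have h1 := Real.exp_one_lt_d9
  have h2 := Real.exp_pos 1
  nlinarith

/-- The error of the labeled samples. The first summand is the square of the coefficient of
`√⟨b, G b⟩` in the bound for the linear part, the second one bounds the degenerate part. The
comparison `λ ≤ 2 τ²` is what turns `τ² / λ` into `τ⁴ / λ²`. -/
theorem labeled_error_le {n k d τ σ lam L : ℝ} (hn : 1 ≤ n) (hk : 1 ≤ k) (hd : 1 ≤ d)
    (hlam : 0 < lam) (hlτ : lam ≤ 2 * τ ^ 2) (hkL : k ≤ 3 * L) :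
    (2 / n * (Real.exp 1 * (sumScale n k * (2 * τ * σ * √(2 / lam))))) ^ 2
      + 2 / n ^ 2 * (Real.exp 1 * (4 * (√d * (2 / lam) * (sumScale n k * (2 * τ * σ)) ^ 2)))
      ≤ 10 ^ 8 * (σ ^ 2 * τ ^ 4 / lam ^ 2 * (√d * L ^ 2 / n)) := by
  have hn0 : 0 < n := by linarith
  have hs : sumScale n k ^ 2 ≤ 1936 * (n * k ^ 2) := by
    refine (sumScale_sq_le (by linarith) (by linarith)).trans ?_
    nlinarith [mul_nonneg hn0.le (mul_nonneg (by linarith : 0 ≤ k) (by linarith : 0 ≤ k - 1)),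
      mul_nonneg (by linarith : 0 ≤ n - 1) (sq_nonneg k)]
  have hd1 : 1 ≤ √d := Real.one_le_sqrt.2 hd
  have he1 := Real.exp_one_lt_d9
  have he2 := exp_one_sq_le
  have h2l : √(2 / lam) ^ 2 = 2 / lam := Real.sq_sqrt (by positivity)
  have e1 : (2 / n * (Real.exp 1 * (sumScale n k * (2 * τ * σ * √(2 / lam))))) ^ 2
      + 2 / n ^ 2 * (Real.exp 1 * (4 * (√d * (2 / lam) * (sumScale n k * (2 * τ * σ)) ^ 2)))
      = (32 * Real.exp 1 ^ 2 + 64 * Real.exp 1 * √d)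
          * (σ ^ 2 * (τ ^ 2 / lam) * (sumScale n k ^ 2 / n ^ 2)) := by
    simp only [mul_pow, h2l]
    field_simp
    ring
  have h3 : 32 * Real.exp 1 ^ 2 + 64 * Real.exp 1 * √d ≤ 411 * √d := by nlinarith
  have h4 : τ ^ 2 / lam ≤ 2 * τ ^ 4 / lam ^ 2 := by
    rw [div_le_div_iff₀ hlam (by positivity)]
    nlinarith [mul_le_mul_of_nonneg_left hlτ (mul_nonneg hlam.le (sq_nonneg τ))]
  have h5 : sumScale n k ^ 2 / n ^ 2 ≤ 1936 * 9 * L ^ 2 / n := by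
    rw [div_le_div_iff₀ (by positivity) hn0]
    have h6 : k ^ 2 ≤ 9 * L ^ 2 := by nlinarith
    calc sumScale n k ^ 2 * n ≤ 1936 * (n * (9 * L ^ 2)) * n := by
          gcongr; exact hs.trans (by gcongr)
      _ = _ := by ring
  rw [e1]
  calc _ ≤ 411 * √d * (σ ^ 2 * (2 * τ ^ 4 / lam ^ 2) * (1936 * 9 * L ^ 2 / n)) := by gcongr
    _ = (411 * 2 * 1936 * 9) * (σ ^ 2 * τ ^ 4 / lam ^ 2 * (√d * L ^ 2 / n)) := by ring
    _ ≤ _ := by gcongr; norm_num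

theorem covariance_error_sq_le {m k τ : ℝ} (hm : 0 < m) (hk : 0 ≤ k) (hkm : k ≤ m) :
    (m⁻¹ * (Real.exp 1 * (sumScale m k * (8 * τ ^ 2)))) ^ 2 ≤ 10 ^ 6 * τ ^ 4 * (k / m) := by
  have hs : sumScale m k ^ 2 ≤ 1936 * (m * k) := by
    refine (sumScale_sq_le hm.le hk).trans ?_
    nlinarith [mul_nonneg hk (sub_nonneg.2 hkm)]
  have he2 := exp_one_sq_le
  calc (m⁻¹ * (Real.exp 1 * (sumScale m k * (8 * τ ^ 2)))) ^ 2
      = 64 * τ ^ 4 * Real.exp 1 ^ 2 * (sumScale m k ^ 2 / m ^ 2) := by field_simp; ring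
    _ ≤ 64 * τ ^ 4 * 7.39 * (1936 * (m * k) / m ^ 2) := by gcongr
    _ = (64 * 7.39 * 1936) * τ ^ 4 * (k / m) := by field_simp
    _ ≤ _ := by gcongr; norm_num

theorem add_log_le_three_mul {d l : ℝ} (hd : 1 ≤ d) (hl : Real.log 2 ≤ l) :
    d + l ≤ 3 * (d * l) := by
  have := Real.log_two_gt_d9
  nlinarith [mul_nonneg (by linarith : 0 ≤ d - 1) (by linarith : 0 ≤ l)]

theorem unlabeled_error_le {m d l τ lam η B : ℝ} (hm : 0 < m) (hd : 1 ≤ d)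
    (hl : Real.log 2 ≤ l) (hlam : 0 < lam) (hlτ : lam ≤ 2 * τ ^ 2)
    (hη : η ^ 2 ≤ 10 ^ 6 * τ ^ 4 * (3 * (d + l) / m)) :
    2 * (24 * η ^ 2 * B ^ 2 / lam ^ 3)
      ≤ 10 ^ 9 * (τ ^ 6 / lam ^ 4 * (d * l / m) * B ^ 2) := by
  have h1 : η ^ 2 ≤ 9 * 10 ^ 6 * τ ^ 4 * (d * l / m) := by
    refine hη.trans ?_
    have h2 := add_log_le_three_mul hd hl
    calc 10 ^ 6 * τ ^ 4 * (3 * (d + l) / m) ≤ 10 ^ 6 * τ ^ 4 * (3 * (3 * (d * l)) / m) := by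
          gcongr
      _ = _ := by ring
  have h3 : τ ^ 4 / lam ^ 3 ≤ 2 * (τ ^ 6 / lam ^ 4) := by
    rw [← mul_div_assoc, div_le_div_iff₀ (by positivity) (by positivity)]
    calc τ ^ 4 * lam ^ 4 = τ ^ 4 * lam ^ 3 * lam := by ring
      _ ≤ τ ^ 4 * lam ^ 3 * (2 * τ ^ 2) := by gcongr
      _ = _ := by ring
  have hdl : 0 ≤ d * l / m := by
    have : 0 ≤ l := by linarith [Real.log_two_gt_d9]
    positivity
  have h6 : 0 ≤ τ ^ 6 := (by decide : Even 6).pow_nonneg τ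
  calc 2 * (24 * η ^ 2 * B ^ 2 / lam ^ 3)
      ≤ 2 * (24 * (9 * 10 ^ 6 * τ ^ 4 * (d * l / m)) * B ^ 2 / lam ^ 3) := by gcongr
    _ = 432 * 10 ^ 6 * (τ ^ 4 / lam ^ 3 * (d * l / m) * B ^ 2) := by ring
    _ ≤ 432 * 10 ^ 6 * (2 * (τ ^ 6 / lam ^ 4) * (d * l / m) * B ^ 2) := by gcongr
    _ = 864 * 10 ^ 6 * (τ ^ 6 / lam ^ 4 * (d * l / m) * B ^ 2) := by ring
    _ ≤ _ := by gcongr; norm_num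

/-- Combination of the two sources of error; the term `c₁ √q` is absorbed into the mean `q`. -/
theorem abs_sub_le_of_parts {V q g c₁ c₂ a : ℝ} (hq : 0 ≤ q)
    (h1 : |V - q| ≤ c₁ * √q + c₂) (h2 : |q - g| ≤ g / 8 + a) (hg : 0 ≤ g) (ha : 0 ≤ a) :
    |V - g| ≤ g / 2 + ((c₁ ^ 2 + c₂) + 2 * a) := by
  have h3 : c₁ * √q ≤ q / 4 + c₁ ^ 2 := by
    nlinarith [sq_nonneg (√q / 2 - c₁), Real.sq_sqrt hq]
  rw [abs_le] at h1 h2 ⊢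
  obtain ⟨h4, h5⟩ := h1
  obtain ⟨h6, h7⟩ := h2
  constructor
  · linarith [hg, ha]
  · linarith [hg, ha]

end Numerics

section Probability

theorem two_mul_exp_neg_le {δ L : ℝ} (hδ₀ : 0 < δ) (hδ₁ : δ < 1) (hL : Real.log (2 / δ) ≤ L)
    {k : ℝ} (hk : L ≤ k) : 2 * Real.exp (-(2 * k)) ≤ δ / 2 := by
  have h1 : Real.exp (-(2 * k)) ≤ (δ / 2) ^ 2 := by
    calc Real.exp (-(2 * k)) ≤ Real.exp (2 * Real.log (δ / 2)) := by
          apply Real.exp_le_exp.2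
          rw [← inv_div, Real.log_inv] at hL
          linarith
      _ = (δ / 2) ^ 2 := by
          rw [mul_comm, Real.exp_mul, Real.exp_log (by positivity)]
          norm_num
  nlinarith

/-- A moment order `k ≥ 2 d + log (2 / δ)` beats the `25 ^ d` pairs of points of the net. -/
theorem net_mul_exp_le {δ : ℝ} (hδ₀ : 0 < δ) (hδ₁ : δ < 1) {d : ℕ} {k : ℝ}
    (hk : 2 * d + Real.log (2 / δ) ≤ k) : 25 ^ d * Real.exp (-(2 * k)) ≤ δ / 2 := by
  have h1 := two_mul_exp_neg_le hδ₀ hδ₁ le_rfl (k := k - 2 * d) (by linarith)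
  have h2 : (25 : ℝ) ≤ Real.exp 4 := by
    have : Real.exp 4 = Real.exp 1 ^ 4 := by rw [← Real.exp_nat_mul]; norm_num
    rw [this]
    have h3 : (2.7 : ℝ) ≤ Real.exp 1 := by linarith [Real.exp_one_gt_d9]
    calc (25 : ℝ) ≤ 2.7 ^ 4 := by norm_num
      _ ≤ Real.exp 1 ^ 4 := by gcongr
  have h3 : Real.exp (-(2 * k)) = (Real.exp 4 ^ d)⁻¹ * Real.exp (-(2 * (k - 2 * d))) := by
    rw [← Real.exp_nat_mul, ← Real.exp_neg, ← Real.exp_add]; ring_nf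
  have h4 : (25 : ℝ) ^ d * (Real.exp 4 ^ d)⁻¹ ≤ 1 := by
    rw [← div_eq_mul_inv, div_le_one (by positivity)]
    gcongr
  rw [h3, ← mul_assoc]
  calc _ ≤ 1 * Real.exp (-(2 * (k - 2 * d))) := by gcongr
    _ ≤ δ / 2 := by linarith [Real.exp_pos (-(2 * (k - 2 * d)))]

/-- The exceptional set of the second moment estimate. -/
theorem measure_covariance_bad_le {ι : Type*} [Fintype ι] [DecidableEq ι]
    {P : Measure (EuclideanSpace ℝ ι × ℝ)} [IsProbabilityMeasure P] {τ : ℝ}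
    (hx : IsSubGVec P (fun p => p.1) τ) (hτ : 0 ≤ τ) {m k : ℕ} (hm : 1 ≤ m) (hk : 1 ≤ k) :
    (Measure.pi fun _ : Fin m => P.map Prod.fst)
        {u | ¬ ‖matOp (empSecondMoment u) - matOp (secondMoment P fun p => p.1)‖
          ≤ (m : ℝ)⁻¹ * (Real.exp 1 * (sumScale m k * (8 * τ ^ 2)))}
      ≤ ENNReal.ofReal (25 ^ Fintype.card ι * Real.exp (-(2 * k))) := by
  have : IsProbabilityMeasure (P.map Prod.fst) :=
    Measure.isProbabilityMeasure_map measurable_fst.aemeasurable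
  have h1 : IsSubGVec (P.map Prod.fst) (fun x : EuclideanSpace ℝ ι => x) τ := by
    intro θ hθ p hp
    rw [eLpNorm_map_measure (by fun_prop) (by fun_prop)]
    exact hx θ hθ p hp
  have h2 : secondMoment (P.map Prod.fst) (fun x : EuclideanSpace ℝ ι => x)
      = secondMoment P fun p => p.1 := by
    ext i j
    simp only [secondMoment, Matrix.of_apply]
    rw [integral_map (by fun_prop) (by fun_prop)]
  have h3 := h1.measure_opNorm_emp_sub_gt_le measurable_id hτ hm hk
  rwa [h2] at h3

/-- The exceptional set of the labeled samples, for a fixed kernel `T - Q`. -/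
theorem SubExpVec.measure_uStat_compressed_gt_le {α E : Type*} [MeasurableSpace α]
    {μ : Measure α} [IsProbabilityMeasure μ] [NormedAddCommGroup E] [InnerProductSpace ℝ E]
    [FiniteDimensional ℝ E] [MeasurableSpace E] [BorelSpace E] {Z : α → E} {b : E} {K : ℝ}
    (hZ : SubExpVec μ Z b K) {n k : ℕ} (hn : 2 ≤ n) (hk : 1 ≤ k) {S T Q : E →L[ℝ] E} {lam : ℝ}
    (hlam : 0 < lam) (hC : CompressedInverse S T Q (19 / 20 * lam)) :
    (Measure.pi fun _ : Fin n => μ) {z |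
        2 / n * (Real.exp 1 * (sumScale n k * (K * √(2 / lam)))) * √(inner ℝ b ((T - Q) b))
          + 2 / (n : ℝ) ^ 2 * (Real.exp 1 *
            (4 * (√(Module.finrank ℝ E) * (2 / lam) * (sumScale n k * K) ^ 2)))
        < |uStat (T - Q) Z z - inner ℝ b ((T - Q) b)|}
      ≤ ENNReal.ofReal (2 * Real.exp (-(2 * k))) := by
  have hinv : (19 / 20 * lam)⁻¹ ≤ 2 / lam := by
    rw [inv_eq_one_div, div_le_div_iff₀ (by positivity) hlam]; linarith
  have hGn : ‖T - Q‖ ≤ 2 / lam := hC.opNorm_le.trans hinv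
  have hGb : ‖(T - Q) b‖ ≤ √(2 / lam) * √(inner ℝ b ((T - Q) b)) := by
    have h1 := hC.norm_sq_le b
    rw [← Real.sqrt_mul (by positivity)]
    apply Real.le_sqrt_of_sq_le
    rw [div_mul_eq_mul_div, le_div_iff₀ hlam]
    nlinarith [mul_nonneg hlam.le (sq_nonneg ‖(T - Q) b‖)]
  have hs0 : 0 ≤ sumScale n k := sumScale_nonneg (by positivity)
  have hK := hZ.nonneg
  refine (measure_mono fun z hz => ?_).trans (hZ.measure_uStat_gt_le hn hk hC.symm)
  rw [Set.mem_ofPred_eq] at hz ⊢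
  refine lt_of_le_of_lt (add_le_add ?_ ?_) hz
  · calc 2 / n * (Real.exp 1 * (sumScale n k * (K * ‖(T - Q) b‖)))
        ≤ 2 / n * (Real.exp 1 * (sumScale n k * (K *
            (√(2 / lam) * √(inner ℝ b ((T - Q) b)))))) := by gcongr
      _ = _ := by ring
  · gcongr

/-- An empirical second moment matrix close to the population one is positive definite. -/
theorem posDef_and_compressedInverse_of_close {ι κ : Type*} [Fintype ι] [DecidableEq ι]
    [Fintype κ] [DecidableEq κ] {S A : Matrix (ι ⊕ κ) (ι ⊕ κ) ℝ} (hS : S.IsHermitian) {lam η : ℝ}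
    (hlam : 0 < lam) (hA : ∀ x, lam * ‖x‖ ^ 2 ≤ inner ℝ x (matOp A x))
    (hη : ‖matOp S - matOp A‖ ≤ η) (hηl : η ≤ lam / 20) :
    S.PosDef ∧
      CompressedInverse (matOp S) (matOp S⁻¹) (matOp (blockInv S)) (19 / 20 * lam) := by
  have hlow : ∀ x, 19 / 20 * lam * ‖x‖ ^ 2 ≤ inner ℝ x (matOp S x) := by
    intro x
    have h1 : inner ℝ x (matOp S x)
        = inner ℝ x (matOp A x) + inner ℝ x ((matOp S - matOp A) x) := by
      rw [← inner_add_right, _root_.sub_apply, add_sub_cancel]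
    have h2 := (abs_le.1 (abs_real_inner_le_norm x ((matOp S - matOp A) x))).1
    have h3 : ‖x‖ * ‖(matOp S - matOp A) x‖ ≤ ‖x‖ * (lam / 20 * ‖x‖) := by
      gcongr
      exact (ContinuousLinearMap.le_opNorm _ _).trans (by gcongr; exact hη.trans hηl)
    linarith [hA x]
  have hpd := posDef_of_lower hS (by positivity) hlow
  exact ⟨hpd, compressedInverse_matOp hpd (by positivity) hlow⟩

theorem measurable_uStat_matOp {Ω α ι : Type*} [Fintype ι] [DecidableEq ι] [MeasurableSpace Ω]
    [MeasurableSpace α] {n : ℕ} {M : Ω → Matrix ι ι ℝ} (hM : ∀ i j, Measurable fun ω => M ω i j)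
    {Z : α → EuclideanSpace ℝ ι} (hZ : Measurable Z) :
    Measurable fun ω : (Fin n → α) × Ω => uStat (matOp (M ω.2)) Z ω.1 := by
  unfold uStat
  refine Measurable.const_mul (Finset.measurable_sum _ fun s _ =>
    Finset.measurable_sum _ fun t _ => measurable_inner_matOp
      (fun i j => (hM i j).comp measurable_snd) ?_ ?_) _ <;> fun_prop

end Probability

end ResidualEstimation

/-! ### The error bound for the estimator -/

theorem theorem1 :
    ∃ C : ℝ, 0 < C ∧ ∃ C' : ℝ, 0 < C' ∧
      ∀ (d₁ d₂ : ℕ) (_hd : 0 < d₁ + d₂)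
        (P : Measure (EuclideanSpace ℝ (Fin d₁ ⊕ Fin d₂) × ℝ)) [IsProbabilityMeasure P]
        (τ σ : ℝ) (_hτ : 0 ≤ τ) (_hσ : 0 ≤ σ)
        (_hx : IsSubGVec P (fun p => p.1) τ) (_hy : IsSubG P (fun p => p.2) σ)
        (_hPD : (secondMoment P (fun p => p.1)).PosDef)
        (β : EuclideanSpace ℝ (Fin d₁ ⊕ Fin d₂)) (β₁ : EuclideanSpace ℝ (Fin d₁))
        (_hβ : IsBestLinear P (fun p => p.1) (fun p => p.2) β)
        (_hβ₁ : IsBestLinear P (fun p => head p.1) (fun p => p.2) β₁)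
        (δ : ℝ) (_hδ₀ : 0 < δ) (_hδ₁ : δ < 1) (n m : ℕ) (_hn : 2 ≤ n)
        (_hm : C * (((d₁ + d₂ : ℕ) : ℝ) + Real.log (2 / δ)) * τ ^ 4 /
          lambdaMin (secondMoment P (fun p => p.1)) ^ 2 ≤ (m : ℝ)),
        sampleLaw P n m
          {ω | ¬ |estimateResidual (empSecondMoment ω.2) (empSecondMoment fun t => head (ω.2 t)) ω.1
                - sqGap P β β₁|
              ≤ sqGap P β β₁ / 2
                + C' * (σ ^ 2 * τ ^ 4 / lambdaMin (secondMoment P (fun p => p.1)) ^ 2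
                      * (√((d₁ + d₂ : ℕ) : ℝ) * Real.log (2 * ((d₁ + d₂ : ℕ) : ℝ) / δ) ^ 2 / n)
                    + τ ^ 6 / lambdaMin (secondMoment P (fun p => p.1)) ^ 4
                      * (((d₁ + d₂ : ℕ) : ℝ) * Real.log (2 / δ) / m)
                      * ‖∫ p, p.2 • p.1 ∂P‖ ^ 2)}
          ≤ ENNReal.ofReal δ := by
  refine ⟨1200000000, by norm_num, 10 ^ 9, by norm_num, ?_⟩
  intro d₁ d₂ hd P _ τ σ hτ hσ hx hy hPD β β₁ hβ hβ₁ δ hδ₀ hδ₁ n m hn hm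
  have hne : Nonempty (Fin d₁ ⊕ Fin d₂) := by
    rw [← Fintype.card_pos_iff]; simpa using hd
  set d : ℝ := ((d₁ + d₂ : ℕ) : ℝ) with hddef
  have hd1 : 1 ≤ d := by rw [hddef]; exact_mod_cast hd
  set lam := lambdaMin (secondMoment P fun p => p.1) with hlamdef
  have hlam : 0 < lam := lambdaMin_pos hPD
  have hlτ : lam ≤ 2 * τ ^ 2 := lambdaMin_le hx measurable_fst hτ
  set l := Real.log (2 / δ) with hl
  have hl2 : Real.log 2 ≤ l := Real.log_le_log (by norm_num) (by rw [le_div_iff₀ hδ₀]; linarith)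
  have hlog2 := Real.log_two_gt_d9
  set L := Real.log (2 * d / δ) with hL
  have hlL : l ≤ L := Real.log_le_log (by positivity) (by gcongr; linarith)
  set b := ∫ p, p.2 • p.1 ∂P with hb
  -- the numbers of moments used for the labeled and for the unlabeled samples
  set k := ⌈L⌉₊ with hkdef
  have hLk : L ≤ k := Nat.le_ceil L
  have hk1 : 1 ≤ k := Nat.one_le_ceil_iff.2 (by linarith)
  have hkL : (k : ℝ) ≤ 3 * L := by linarith [Nat.ceil_lt_add_one (show 0 ≤ L by linarith)]
  set k' := ⌈2 * d + l⌉₊ with hkdef'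
  have hdk' : 2 * d + l ≤ k' := Nat.le_ceil _
  have hk1' : 1 ≤ k' := Nat.one_le_ceil_iff.2 (by linarith)
  have hkd' : (k' : ℝ) ≤ 3 * (d + l) := by
    linarith [Nat.ceil_lt_add_one (show 0 ≤ 2 * d + l by linarith)]
  have hm' : 1200000000 * (d + l) * τ ^ 4 ≤ m * lam ^ 2 := by
    rwa [div_le_iff₀ (by positivity)] at hm
  have hτlam : lam ^ 2 ≤ 4 * τ ^ 4 := by nlinarith
  have hkm : (k' : ℝ) ≤ m := by
    have h1 : 3 * (d + l) * lam ^ 2 ≤ m * lam ^ 2 := by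
      nlinarith [mul_le_mul_of_nonneg_left hτlam (by linarith : 0 ≤ d + l)]
    exact hkd'.trans (le_of_mul_le_mul_right h1 (by positivity))
  have hm1 : 1 ≤ m := by
    have : (1 : ℝ) ≤ k' := by exact_mod_cast hk1'
    exact_mod_cast this.trans hkm
  have hm0 : (0 : ℝ) < m := by positivity
  -- `η` bounds the error of the second moment matrix; `1200000000 = 3 * 10 ^ 6 * 20 ^ 2` makes it
  -- at most `lam / 20`
  set η := (m : ℝ)⁻¹ * (Real.exp 1 * (sumScale m k' * (8 * τ ^ 2))) with hηdef
  have hη0 : 0 ≤ η := by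
    have := sumScale_nonneg (N := m) (k := k') (by positivity)
    positivity
  have hη2 : η ^ 2 ≤ 10 ^ 6 * τ ^ 4 * (3 * (d + l) / m) :=
    (covariance_error_sq_le hm0 (by positivity) hkm).trans (by gcongr)
  have hηl : η ≤ lam / 20 := by
    refine le_of_sq_le_sq (hη2.trans ?_) (by positivity)
    rw [← mul_div_assoc, div_le_iff₀ hm0]
    linarith
  -- conditionally on the unlabeled samples, the fluctuation is at most `c₁ √⟨b, G b⟩ + c₂`
  set c₁ := 2 / n * (Real.exp 1 * (sumScale n k * (2 * τ * σ * √(2 / lam)))) with hc₁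
  set c₂ := 2 / (n : ℝ) ^ 2 *
    (Real.exp 1 * (4 * (√d * (2 / lam) * (sumScale n k * (2 * τ * σ)) ^ 2))) with hc₂
  let Z : EuclideanSpace ℝ (Fin d₁ ⊕ Fin d₂) × ℝ → EuclideanSpace ℝ (Fin d₁ ⊕ Fin d₂) :=
    fun p => p.2 • p.1
  have hZ : SubExpVec P Z b (2 * τ * σ) :=
    subExpVec_smul hτ hσ hx hy measurable_fst measurable_snd
  let M : (Fin m → EuclideanSpace ℝ (Fin d₁ ⊕ Fin d₂)) →
      Matrix (Fin d₁ ⊕ Fin d₂) (Fin d₁ ⊕ Fin d₂) ℝ := fun u =>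
    (empSecondMoment u)⁻¹ - blockInv (empSecondMoment u)
  let good : Set (Fin m → EuclideanSpace ℝ (Fin d₁ ⊕ Fin d₂)) :=
    {u | ‖matOp (empSecondMoment u) - matOp (secondMoment P fun p => p.1)‖ ≤ η}
  have hA : ∀ x, lam * ‖x‖ ^ 2 ≤ inner ℝ x (matOp (secondMoment P fun p => p.1) x) :=
    lambdaMin_mul_norm_sq_le hPD.isHermitian
  have hgood : ∀ u ∈ good, (empSecondMoment u).PosDef ∧
      CompressedInverse (matOp (empSecondMoment u)) (matOp (empSecondMoment u)⁻¹)
        (matOp (blockInv (empSecondMoment u))) (19 / 20 * lam) := fun u hu =>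
    posDef_and_compressedInverse_of_close (empSecondMoment_isHermitian u) hlam hA hu hηl
  have hMm := fun i j => measurable_sub_blockInv_entry
    (M := fun u : Fin m → EuclideanSpace ℝ (Fin d₁ ⊕ Fin d₂) => empSecondMoment u)
    measurable_empSecondMoment_entry i j
  -- `W` is stated through matrix inverses instead of pseudoinverses, so that it is measurable and
  -- its measure can be computed by sections
  let W : Set ((Fin n → EuclideanSpace ℝ (Fin d₁ ⊕ Fin d₂) × ℝ) ×
      (Fin m → EuclideanSpace ℝ (Fin d₁ ⊕ Fin d₂))) :=
    {ω | ω.2 ∈ good ∧ c₁ * √(inner ℝ b (matOp (M ω.2) b)) + c₂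
      < |uStat (matOp (M ω.2)) Z ω.1 - inner ℝ b (matOp (M ω.2) b)|}
  have hWm : MeasurableSet W := by
    have g1 : MeasurableSet good := by
      have h1 := measurable_norm_matOp (M := fun u : Fin m → EuclideanSpace ℝ (Fin d₁ ⊕ Fin d₂) =>
        empSecondMoment u - secondMoment P fun p => p.1)
        (fun i j => (measurable_empSecondMoment_entry i j).sub_const _)
      simp only [map_sub] at h1
      exact measurableSet_le h1 measurable_const
    have hM2 : ∀ i j, Measurable fun ω : (Fin n → EuclideanSpace ℝ (Fin d₁ ⊕ Fin d₂) × ℝ) ×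
        (Fin m → EuclideanSpace ℝ (Fin d₁ ⊕ Fin d₂)) => M ω.2 i j := fun i j =>
      (hMm i j).comp measurable_snd
    have g2 := measurable_inner_matOp hM2 (measurable_const (a := b)) (measurable_const (a := b))
    have g3 := measurable_uStat_matOp (n := n) hMm hZ.measurable
    exact (measurable_snd g1).inter (measurableSet_lt ((g2.sqrt.const_mul _).add_const _)
      (g3.sub g2).abs)
  have hsection : ∀ u, (Measure.pi fun _ : Fin n => P) ((fun z => (z, u)) ⁻¹' W)
      ≤ ENNReal.ofReal (δ / 2) := by
    intro u
    by_cases hu : u ∈ good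
    swap
    · have : (fun z => (z, u)) ⁻¹' W = ∅ := by
        ext z; simp [W, hu]
      rw [this]; simp
    obtain ⟨hpd, hC⟩ := hgood u hu
    have hG : matOp (M u) = matOp (empSecondMoment u)⁻¹ - matOp (blockInv (empSecondMoment u)) :=
      map_sub _ _ _
    have h2 := hZ.measure_uStat_compressed_gt_le hn hk1 hlam hC
    rw [finrank_euclideanSpace, Fintype.card_sum, Fintype.card_fin, Fintype.card_fin, ← hG] at h2
    exact (measure_mono fun z hz => hz.2).trans (h2.trans (ENNReal.ofReal_le_ofReal
      (two_mul_exp_neg_le hδ₀ hδ₁ hlL hLk)))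
  have hWle : sampleLaw P n m W ≤ ENNReal.ofReal (δ / 2) := by
    have : IsProbabilityMeasure (P.map Prod.fst) :=
      Measure.isProbabilityMeasure_map measurable_fst.aemeasurable
    rw [sampleLaw, Measure.prod_apply_symm hWm]
    refine (lintegral_mono hsection).trans ?_
    simp
  have hUle : sampleLaw P n m (Set.univ ×ˢ goodᶜ) ≤ ENNReal.ofReal (δ / 2) := by
    have : IsProbabilityMeasure (P.map Prod.fst) :=
      Measure.isProbabilityMeasure_map measurable_fst.aemeasurable
    rw [sampleLaw, Measure.prod_prod, measure_univ, one_mul]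
    refine (measure_covariance_bad_le hx hτ hm1 hk1').trans (ENNReal.ofReal_le_ofReal ?_)
    rw [Fintype.card_sum, Fintype.card_fin, Fintype.card_fin]
    exact net_mul_exp_le hδ₀ hδ₁ hdk'
  have hδ2 : ENNReal.ofReal δ = ENNReal.ofReal (δ / 2) + ENNReal.ofReal (δ / 2) := by
    rw [← ENNReal.ofReal_add (by positivity) (by positivity), add_halves]
  rw [hδ2]
  refine (measure_mono ?_).trans ((measure_union_le (Set.univ ×ˢ goodᶜ) W).trans
    (add_le_add hUle hWle))
  rintro ⟨z, u⟩ hbad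
  by_contra hcon
  simp only [Set.mem_union, Set.mem_prod, Set.mem_univ, true_and, Set.mem_compl_iff, not_or,
    not_not] at hcon
  obtain ⟨hu, hzW⟩ := hcon
  refine hbad ?_
  obtain ⟨hpd, hC⟩ := hgood u hu
  have hG : matOp (M u) = matOp (empSecondMoment u)⁻¹ - matOp (blockInv (empSecondMoment u)) :=
    map_sub _ _ _
  have hest : estimateResidual (empSecondMoment u) (empSecondMoment fun t => head (u t)) z
      = uStat (matOp (M u)) Z z := by
    rw [← toBlocks₁₁_empSecondMoment, estimateResidual_eq_uStat hpd, hG]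
  have hpart1 : |uStat (matOp (M u)) Z z - inner ℝ b (matOp (M u) b)|
      ≤ c₁ * √(inner ℝ b (matOp (M u) b)) + c₂ := by
    by_contra! h
    exact hzW ⟨hu, h⟩
  have hpart2 := abs_mean_sub_sqGap_le hτ hσ hx hy hβ hβ₁ hpd hC rfl hu hηl hA
  rw [← hG] at hpart2
  have hq0 : 0 ≤ inner ℝ b (matOp (M u) b) := by
    have := hC.norm_sq_le b
    rw [← hG] at this
    have h1 : 0 ≤ 19 / 20 * lam * ‖matOp (M u) b‖ ^ 2 := by positivity
    exact h1.trans this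
  have hg0 : 0 ≤ sqGap P β β₁ := integral_nonneg fun _ => sq_nonneg _
  have hfin := abs_sub_le_of_parts hq0 hpart1 hpart2 hg0 (by positivity)
  simp only [hest]
  refine hfin.trans ?_
  rw [mul_add]
  refine add_le_add le_rfl (add_le_add ?_ ?_)
  · refine (labeled_error_le (by exact_mod_cast (by omega : 1 ≤ n)) (by exact_mod_cast hk1) hd1 hlam
      hlτ hkL).trans ?_
    gcongr <;> norm_num
  · exact unlabeled_error_le hm0 hd1 hl2 hlam hlτ hη2
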